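/- Let $n\in\{2,3\}$ and let $\Omega\subset\mathbb R^n$ be a bounded domain with Lipschitz continuous boundary $S$, surface measure $ds$ and unit outward normal $\nu$ (both computed in local Lipschitz graph coordinates; Sobolev functions on $\Omega$ have boundary values in the sense of traces). Let $S_1,S_2$ be disjoint relatively open subsets of $S$ with $S_1\neq\emptyset$, $S=\overline{S_1}\cup\overline{S_2}$ and $S\setminus(S_1\cup S_2)$ of surface measure zero. Put $$X=\{u\in H^1(\Omega)^n: u|_{S_1}=0\},\qquad V=\{u\in X:\operatorname{div}u=0\},$$ $\varepsilon_{ij}(u)=\frac12\left(\frac{\partial u_i}{\partial x_j}+\frac{\partial u_j}{\partial x_i}\right)$, $I(u)=\sum_{i,j}\varepsilon_{ij}(u)^2$; repeated indices are summed. Let $E:\Omega\to\mathbb R^n$ be measurable (the electric field), $\check u\in\mathbb R^n$, $\alpha\ge 0$, and let $$\mu(u,E)(x)=\left(\frac{\alpha\mathbf 1+u(x)+\check u}{\alpha\sqrt n+|u(x)+\check u|},\frac{E(x)}{|E(x)|}\right)_{\mathbb R^n}^2,\qquad \mathbf 1=(1,\dots,1),$$ with $\mu(u,E)(x)=0$ where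 $E(x)=0$; the value $\alpha=0$ is permitted only if $u+\check u\neq0$ a.e. in $\Omega$ for the solution $u$ below. Let $b:\mathbb R_+\times[0,1]\to\mathbb R$ be continuous with $0\le b\le a_5$ for some $a_5>0$, and let $\psi:\mathbb R_+^2\times[0,1]\to\mathbb R$ be continuous with $a_1\le\psi\le a_2$ for some $a_1,a_2>0$ and satisfy one of the following: 1. for all $y_2,y_3$ the function $y_1\mapsto\psi(y_1,y_2,y_3)$ is continuously differentiable on $\mathbb R_+=[0,\infty)$, and $\psi+2\frac{\partial\psi}{\partial y_1}y_1\ge a_3$, $\left|\frac{\partial\psi}{\partial y_1}\right|y_1\le a_4$ everywhere, with constants $a_3,a_4>0$; 2. $[\psi(z_1^2,y_2,y_3)z_1-\psi(z_2^2,y_2,y_3)z_2](z_1-z_2)\ge a_3(z_1-z_2)^2$ for all $z_1,z_2\in\mathbb R_+$ and all $y_2,y_3$, with a constant $a_3>0$; 3. for all $y_2,y_3$ the function $z\mapsto\psi(z^2,y_2,y_3)z$ is strictly increasing on $\mathbb R_+$. Consider the singular viscosity $$\phi(I(u),|E|,\mu(u,E))=\frac{b(|E|,\mu(u,E))}{I(u)^{1/2}}+\psi(I(u),|E|,\mu(u,E)),$$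 which is infinite where $I(u)=0$ and $b(|E|,\mu(u,E))>0$, and is understood as $\psi$ where $I(u)=0$ and $b(|E|,\mu(u,E))=0$. Let $K\in L_2(\Omega)^n$, $F\in L_2(S_2)^n$, let $\hat u$ be a given velocity on $S_1$, and let $\tilde u\in H^1(\Omega)^n$ satisfy $\tilde u|_{S_1}=\hat u$ and $\operatorname{div}\tilde u=0$. A pair $(u,p)$ is called a regular solution if $u\in H^1(\Omega)^n$, the viscosity $\phi$ is finite a.e. in $\Omega$, $p\in H^1(\Omega)$ and $\phi\,\varepsilon_{ij}(u)\in H^1(\Omega)$ for all $i,j$, and, for $i=1,\dots,n$, $$\frac{\partial p}{\partial x_i}-2\frac{\partial}{\partial x_j}\big[\phi(I(u),|E|,\mu(u,E))\,\varepsilon_{ij}(u)\big]=K_i,\qquad \operatorname{div}u=0\qquad\text{a.e. in }\Omega,$$ $$u|_{S_1}=\hat u,\qquad \big[-p\,\delta_{ij}+2\phi(I(u),|E|,\mu(u,E))\,\varepsilon_{ij}(u)\big]\nu_j\big|_{S_2}=F_i.$$ For $v,h\in X$ put $$J(v,h)=2\int_\Omega b(|E|,\mu(\tilde u+v,E))\,I(\tilde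 u+h)^{1/2}\,dx,$$ $$(L(v),h)=2\int_\Omega\psi(I(\tilde u+v),|E|,\mu(\tilde u+v,E))\,\varepsilon_{ij}(\tilde u+v)\,\varepsilon_{ij}(h)\,dx,$$ $$(K+F,h)=\int_\Omega K_ih_i\,dx+\int_{S_2}F_ih_i\,ds.$$ Theorem. If $(u,p)$ with $u=\tilde u+v$ is a regular solution, then $v\in V$ and $$J(v,h)-J(v,v)+(L(v),h-v)\ge(K+F,h-v)\qquad\text{for all }h\in V.$$ -/

import Mathlib

open MeasureTheory Set Filter Topology
open scoped ContDiff ENNReal NNReal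

namespace ERFluid

noncomputable section

/-- Euclidean space `ℝⁿ`. -/
abbrev Vec (n : ℕ) := EuclideanSpace ℝ (Fin n)

/-- The `i`-th standard basis vector. -/
def basisVec {n : ℕ} (i : Fin n) : Vec n := EuclideanSpace.single i 1

/-! ### Lipschitz boundaries, surface measure, outward normal -/

/-- A local coordinate system: an open set `U`, an orthonormal change of coordinates
`ℝⁿ⁻¹ × ℝ ≃ ℝⁿ`, and a Lipschitz function `γ` of the first `n - 1` new coordinates. -/
structure LipschitzChart (n : ℕ) where
  U : Set (Vec n)
  isOpen_U : IsOpen U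
  frame : WithLp 2 (Vec (n - 1) × ℝ) ≃ₗᵢ[ℝ] Vec n
  γ : Vec (n - 1) → ℝ
  lipschitz : ∃ K : ℝ≥0, LipschitzWith K γ

namespace LipschitzChart

variable {n : ℕ} (c : LipschitzChart n)

/-- The parametrization `y ↦ (y, γ y)` of the graph of `γ`, in the original coordinates. -/
def graphMap (y : Vec (n - 1)) : Vec n := c.frame (WithLp.toLp 2 (y, c.γ y))

/-- The (unbounded) region `{(y, t) : γ y < t}` above the graph. -/
def epigraph : Set (Vec n) :=
  {x | c.γ (c.frame.symm x).fst < (c.frame.symm x).snd}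

/-- The area element `√(1 + |∇γ|²)`. -/
def areaElement (y : Vec (n - 1)) : ℝ := Real.sqrt (1 + ‖gradient c.γ y‖ ^ 2)

/-- The surface measure `√(1 + |∇γ|²) dy` of the graph of `γ`, as a measure on `ℝⁿ`. -/
def graphMeasure : Measure (Vec n) :=
  (volume.withDensity fun y => ENNReal.ofReal (c.areaElement y)).map c.graphMap

/-- The unit normal `(∇γ, -1) / √(1 + |∇γ|²)` to the graph, pointing away from the epigraph. -/
def graphNormal (x : Vec n) : Vec n :=
  let y := (c.frame.symm x).fst
  (c.areaElement y)⁻¹ • c.frame (WithLp.toLp 2 (gradient c.γ y, -1))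

end LipschitzChart

/-- A description of the boundary of `Ω` as a Lipschitz continuous boundary: finitely many local
coordinate systems whose domains cover the boundary and in each of which `Ω` is the set above the
graph of a Lipschitz function. -/
structure LipschitzBoundary {n : ℕ} (Ω : Set (Vec n)) where
  N : ℕ
  chart : Fin N → LipschitzChart n
  cover : frontier Ω ⊆ ⋃ k, (chart k).U
  eq_epigraph : ∀ k, Ω ∩ (chart k).U = (chart k).epigraph ∩ (chart k).U

namespace LipschitzBoundary

variable {n : ℕ} {Ω : Set (Vec n)} (A : LipschitzBoundary Ω)

/-- The pieces `U_k \ ⋃_{l < k} U_l`: pairwise disjoint Borel sets that cover the boundary. -/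
def piece (k : Fin A.N) : Set (Vec n) :=
  (A.chart k).U \ ⋃ l : Fin A.N, ⋃ _ : l < k, (A.chart l).U

/-- The surface measure `ds` on the boundary, as a measure on `ℝⁿ`
(it does not depend on the coordinate systems). -/
def surfaceMeasure : Measure (Vec n) :=
  Measure.sum fun k => ((A.chart k).graphMeasure).restrict (A.piece k)

/-- The unit outward normal on the boundary, determined almost everywhere. -/
def normal (x : Vec n) : Vec n :=
  ∑ k, (A.piece k).indicator (A.chart k).graphNormal x

end LipschitzBoundary

/-- `S₁`, `S₂` are disjoint relatively open subsets of the boundary `S` of `Ω`, `S₁` is non-empty,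
`S` is the union of their closures, and `S \ (S₁ ∪ S₂)` has surface measure zero. -/
structure IsBoundarySplitting {n : ℕ} {Ω : Set (Vec n)} (A : LipschitzBoundary Ω)
    (S₁ S₂ : Set (Vec n)) : Prop where
  open_fst : ∃ O, IsOpen O ∧ S₁ = O ∩ frontier Ω
  open_snd : ∃ O, IsOpen O ∧ S₂ = O ∩ frontier Ω
  nonempty_fst : S₁.Nonempty
  disjoint : Disjoint S₁ S₂
  union_closure : closure S₁ ∪ closure S₂ = frontier Ω
  interface_null : A.surfaceMeasure (frontier Ω \ (S₁ ∪ S₂)) = 0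

/-! ### Weak derivatives, the space `H¹(Ω)`, traces

Functions on `Ω` and on its boundary are represented by functions on `ℝⁿ`; only their values
almost everywhere on `Ω`, respectively on the boundary, matter. -/

/-- `g` is the weak partial derivative `∂f/∂xᵢ` in `Ω`. -/
def IsWeakPartial {n : ℕ} (Ω : Set (Vec n)) (f : Vec n → ℝ) (i : Fin n) (g : Vec n → ℝ) : Prop :=
  ∀ φ : Vec n → ℝ, ContDiff ℝ ∞ φ → HasCompactSupport φ → tsupport φ ⊆ Ω →
    ∫ x in Ω, f x * fderiv ℝ φ x (basisVec i) = - ∫ x in Ω, g x * φ x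

/-- `f ∈ H¹(Ω)`. -/
def MemH1 {n : ℕ} (Ω : Set (Vec n)) (f : Vec n → ℝ) : Prop :=
  MemLp f 2 (volume.restrict Ω) ∧
    ∀ i, ∃ g, MemLp g 2 (volume.restrict Ω) ∧ IsWeakPartial Ω f i g

open Classical in
/-- The weak partial derivative `∂f/∂xᵢ ∈ L²(Ω)` of `f ∈ H¹(Ω)` (it is unique almost everywhere
in `Ω`). -/
def weakPartial {n : ℕ} (Ω : Set (Vec n)) (f : Vec n → ℝ) (i : Fin n) : Vec n → ℝ :=
  if h : ∃ g, MemLp g 2 (volume.restrict Ω) ∧ IsWeakPartial Ω f i g then h.choose else 0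

/-- `g ∈ L²(S)` is the trace of `f ∈ H¹(Ω)` on the boundary `S`: some sequence of smooth functions
on `ℝⁿ` converges to `f` in `H¹(Ω)` while its boundary values converge to `g` in `L²(S)`. -/
def IsTrace {n : ℕ} {Ω : Set (Vec n)} (A : LipschitzBoundary Ω) (f g : Vec n → ℝ) : Prop :=
  MemLp g 2 A.surfaceMeasure ∧
  ∃ w : ℕ → Vec n → ℝ, (∀ k, ContDiff ℝ ∞ (w k)) ∧
    Tendsto (fun k => eLpNorm (fun x => w k x - f x) 2 (volume.restrict Ω)) atTop (𝓝 0) ∧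
    (∀ i, Tendsto (fun k => eLpNorm
      (fun x => fderiv ℝ (w k) x (basisVec i) - weakPartial Ω f i x) 2 (volume.restrict Ω))
      atTop (𝓝 0)) ∧
    Tendsto (fun k => eLpNorm (fun x => w k x - g x) 2 A.surfaceMeasure) atTop (𝓝 0)

open Classical in
/-- The trace of `f ∈ H¹(Ω)` (unique almost everywhere on the boundary). -/
def trace {n : ℕ} {Ω : Set (Vec n)} (A : LipschitzBoundary Ω) (f : Vec n → ℝ) : Vec n → ℝ :=
  if h : ∃ g, IsTrace A f g then h.choose else 0

/-- `u ∈ H¹(Ω)ⁿ`. -/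
def MemH1Vec {n : ℕ} (Ω : Set (Vec n)) (u : Vec n → Vec n) : Prop :=
  ∀ i, MemH1 Ω fun x => u x i

/-- `u = ub` (the given boundary velocity) on the part `S₁` of the boundary, in the sense of traces. -/
def EqOnBoundary {n : ℕ} {Ω : Set (Vec n)} (A : LipschitzBoundary Ω) (S₁ : Set (Vec n))
    (u ub : Vec n → Vec n) : Prop :=
  ∀ i, ∃ g, IsTrace A (fun x => u x i) g ∧ ∀ᵐ x ∂(A.surfaceMeasure.restrict S₁), g x = ub x i

/-- `div u = 0` in `Ω`. -/
def DivFree {n : ℕ} (Ω : Set (Vec n)) (u : Vec n → Vec n) : Prop :=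
  ∀ᵐ x ∂(volume.restrict Ω), ∑ i, weakPartial Ω (fun z => u z i) i x = 0

/-- The space `X` of those `u ∈ H¹(Ω)ⁿ` with `u = 0` on `S₁`. -/
def X {n : ℕ} {Ω : Set (Vec n)} (A : LipschitzBoundary Ω) (S₁ : Set (Vec n)) :
    Set (Vec n → Vec n) :=
  {u | MemH1Vec Ω u ∧ EqOnBoundary A S₁ u 0}

/-- The space `V` of the divergence free elements of `X`. -/
def V {n : ℕ} {Ω : Set (Vec n)} (A : LipschitzBoundary Ω) (S₁ : Set (Vec n)) :
    Set (Vec n → Vec n) :=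
  {u | u ∈ X A S₁ ∧ DivFree Ω u}

/-! ### Kinematics -/

/-- The rate of strain tensor `ε_ij(u) = (∂u_i/∂x_j + ∂u_j/∂x_i) / 2`. -/
def strain {n : ℕ} (Ω : Set (Vec n)) (u : Vec n → Vec n) (i j : Fin n) (x : Vec n) : ℝ :=
  (weakPartial Ω (fun z => u z i) j x + weakPartial Ω (fun z => u z j) i x) / 2

/-- The second invariant `I(u) = ∑ ε_ij(u)²`. -/
def inv2 {n : ℕ} (Ω : Set (Vec n)) (u : Vec n → Vec n) (x : Vec n) : ℝ :=
  ∑ i, ∑ j, strain Ω u i j x ^ 2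

/-- The function `μ(u,E)`: the square of the scalar product of
`(α 𝟙 + u + uc) / (α √n + |u + uc|)` and `E / |E|`, where `𝟙 = (1,…,1)` and `uc` is the constant
velocity of the frame of reference. It is `0` where `E = 0`. -/
def angle {n : ℕ} (α : ℝ) (uc : Vec n) (u E : Vec n → Vec n) (x : Vec n) : ℝ :=
  (inner ℝ ((α * Real.sqrt n + ‖u x + uc‖)⁻¹ • (α • WithLp.toLp 2 (fun _ : Fin n => (1 : ℝ))
      + u x + uc)) (‖E x‖⁻¹ • E x)) ^ 2

/-! ### Material functions -/

/-- `ψ` is continuous on `ℝ₊² × [0,1]`. -/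
def ContinuousMaterial (ψ : ℝ → ℝ → ℝ → ℝ) : Prop :=
  ContinuousOn (fun y : ℝ × ℝ × ℝ => ψ y.1 y.2.1 y.2.2) (Ici 0 ×ˢ Ici 0 ×ˢ Icc 0 1)

/-- First admissible class for `ψ`: continuous, bounded between positive constants, continuously
differentiable in `y₁ ∈ [0,∞)` (one-sided at `0`), with `ψ + 2 y₁ ∂ψ/∂y₁ ≥ a₃` and
`|∂ψ/∂y₁| y₁ ≤ a₄`. -/
def DifferentiableMaterial (ψ : ℝ → ℝ → ℝ → ℝ) : Prop :=
  ContinuousMaterial ψ ∧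
  (∀ y₂ ∈ Ici (0 : ℝ), ∀ y₃ ∈ Icc (0 : ℝ) 1,
    ContDiffOn ℝ 1 (fun y₁ => ψ y₁ y₂ y₃) (Ici 0)) ∧
  ∃ a₁ a₂ a₃ a₄ : ℝ, 0 < a₁ ∧ 0 < a₂ ∧ 0 < a₃ ∧ 0 < a₄ ∧
    ∀ y₁ ∈ Ici (0 : ℝ), ∀ y₂ ∈ Ici (0 : ℝ), ∀ y₃ ∈ Icc (0 : ℝ) 1,
      a₁ ≤ ψ y₁ y₂ y₃ ∧ ψ y₁ y₂ y₃ ≤ a₂ ∧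
      a₃ ≤ ψ y₁ y₂ y₃ + 2 * derivWithin (fun y => ψ y y₂ y₃) (Ici 0) y₁ * y₁ ∧
      |derivWithin (fun y => ψ y y₂ y₃) (Ici 0) y₁| * y₁ ≤ a₄

/-- Second admissible class for `ψ`: continuous, bounded between positive constants, and
`z ↦ ψ(z²,y₂,y₃) z` is strongly increasing. -/
def StronglyMonotoneMaterial (ψ : ℝ → ℝ → ℝ → ℝ) : Prop :=
  ContinuousMaterial ψ ∧
  ∃ a₁ a₂ a₃ : ℝ, 0 < a₁ ∧ 0 < a₂ ∧ 0 < a₃ ∧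
    ∀ y₂ ∈ Ici (0 : ℝ), ∀ y₃ ∈ Icc (0 : ℝ) 1,
      (∀ y₁ ∈ Ici (0 : ℝ), a₁ ≤ ψ y₁ y₂ y₃ ∧ ψ y₁ y₂ y₃ ≤ a₂) ∧
      ∀ z₁ ∈ Ici (0 : ℝ), ∀ z₂ ∈ Ici (0 : ℝ),
        a₃ * (z₁ - z₂) ^ 2 ≤
          (ψ (z₁ ^ 2) y₂ y₃ * z₁ - ψ (z₂ ^ 2) y₂ y₃ * z₂) * (z₁ - z₂)

/-- Third admissible class for `ψ`: continuous, bounded between positive constants, and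
`z ↦ ψ(z²,y₂,y₃) z` is strictly increasing on `ℝ₊`. -/
def StrictlyMonotoneMaterial (ψ : ℝ → ℝ → ℝ → ℝ) : Prop :=
  ContinuousMaterial ψ ∧
  ∃ a₁ a₂ : ℝ, 0 < a₁ ∧ 0 < a₂ ∧
    ∀ y₂ ∈ Ici (0 : ℝ), ∀ y₃ ∈ Icc (0 : ℝ) 1,
      (∀ y₁ ∈ Ici (0 : ℝ), a₁ ≤ ψ y₁ y₂ y₃ ∧ ψ y₁ y₂ y₃ ≤ a₂) ∧
      StrictMonoOn (fun z => ψ (z ^ 2) y₂ y₃ * z) (Ici 0)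

/-- The plasticity coefficient `b` is continuous on `ℝ₊ × [0,1]` with `0 ≤ b ≤ a₅`. -/
def PlasticityCoefficient (b : ℝ → ℝ → ℝ) : Prop :=
  ContinuousOn (fun y : ℝ × ℝ => b y.1 y.2) (Ici 0 ×ˢ Icc 0 1) ∧
  ∃ a₅ : ℝ, 0 < a₅ ∧ ∀ y₁ ∈ Ici (0 : ℝ), ∀ y₂ ∈ Icc (0 : ℝ) 1, 0 ≤ b y₁ y₂ ∧ b y₁ y₂ ≤ a₅

/-- The values of the viscosity `φ(I(u),|E|,μ(u,E)) = b(|E|,μ(u,E)) / I(u)^{1/2} +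
ψ(I(u),|E|,μ(u,E))` at points where it is finite, i.e. where `I(u) ≠ 0` or `b(|E|,μ(u,E)) = 0`
(in the latter case `φ = ψ`). -/
def viscosity {n : ℕ} (Ω : Set (Vec n)) (α : ℝ) (uc : Vec n) (E : Vec n → Vec n)
    (b : ℝ → ℝ → ℝ) (ψ : ℝ → ℝ → ℝ → ℝ) (u : Vec n → Vec n) (x : Vec n) : ℝ :=
  b ‖E x‖ (angle α uc u E x) / Real.sqrt (inv2 Ω u x)
    + ψ (inv2 Ω u x) ‖E x‖ (angle α uc u E x)

/-- `(u,p)` is a regular solution of the mixed boundary value problem: `u ∈ H¹(Ω)ⁿ`, the viscosity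
is finite almost everywhere, the pressure `p` and the components `φ ε_ij(u)` are in `H¹(Ω)`, the
equations of motion and incompressibility hold almost everywhere in `Ω`, and the conditions on the
velocity on `S₁` and on the stress on `S₂` hold almost everywhere in the sense of traces. -/
structure IsRegularSolution {n : ℕ} {Ω : Set (Vec n)} (A : LipschitzBoundary Ω)
    (S₁ S₂ : Set (Vec n)) (α : ℝ) (uc : Vec n) (E : Vec n → Vec n)
    (b : ℝ → ℝ → ℝ) (ψ : ℝ → ℝ → ℝ → ℝ) (K F ub : Vec n → Vec n)
    (u : Vec n → Vec n) (p : Vec n → ℝ) : Prop where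
  velocity_mem : MemH1Vec Ω u
  viscosity_finite : ∀ᵐ x ∂(volume.restrict Ω),
    inv2 Ω u x = 0 → b ‖E x‖ (angle α uc u E x) = 0
  pressure_mem : MemH1 Ω p
  stress_mem : ∀ i j, MemH1 Ω fun x => viscosity Ω α uc E b ψ u x * strain Ω u i j x
  momentum : ∀ i, ∀ᵐ x ∂(volume.restrict Ω),
    weakPartial Ω p i x - 2 * ∑ j,
      weakPartial Ω (fun z => viscosity Ω α uc E b ψ u z * strain Ω u i j z) j x = K x i
  incompressible : DivFree Ω u
  velocity_boundary : EqOnBoundary A S₁ u ub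
  stress_boundary : ∃ (q : Vec n → ℝ) (T : Fin n → Fin n → Vec n → ℝ),
    IsTrace A p q ∧
    (∀ i j, IsTrace A (fun x => viscosity Ω α uc E b ψ u x * strain Ω u i j x) (T i j)) ∧
    ∀ i, ∀ᵐ x ∂(A.surfaceMeasure.restrict S₂),
      ∑ j, (-(q x) * (if i = j then 1 else 0) + 2 * T i j x) * A.normal x j = F x i

/-! ### The variational inequality -/

/-- `J(v,h) = 2 ∫_Ω b(|E|,μ(ut+v,E)) I(ut+h)^{1/2} dx`, where `ut` is the lift of
the boundary velocity. -/
def J {n : ℕ} (Ω : Set (Vec n)) (α : ℝ) (uc : Vec n) (E : Vec n → Vec n)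
    (b : ℝ → ℝ → ℝ) (ut v h : Vec n → Vec n) : ℝ :=
  2 * ∫ x in Ω, b ‖E x‖ (angle α uc (ut + v) E x) * Real.sqrt (inv2 Ω (ut + h) x)

/-- `(L(v),h) = 2 ∫_Ω ψ(I(ut+v),|E|,μ(ut+v,E)) ε_ij(ut+v) ε_ij(h) dx`. -/
def L {n : ℕ} (Ω : Set (Vec n)) (α : ℝ) (uc : Vec n) (E : Vec n → Vec n)
    (ψ : ℝ → ℝ → ℝ → ℝ) (ut v h : Vec n → Vec n) : ℝ :=
  2 * ∫ x in Ω, ψ (inv2 Ω (ut + v) x) ‖E x‖ (angle α uc (ut + v) E x) *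
    ∑ i, ∑ j, strain Ω (ut + v) i j x * strain Ω h i j x

/-- `(K,h) = ∫_Ω K_i h_i dx`. -/
def volumeWork {n : ℕ} (Ω : Set (Vec n)) (K h : Vec n → Vec n) : ℝ :=
  ∫ x in Ω, ∑ i, K x i * h x i

/-- `(F,h) = ∫_{S₂} F_i h_i ds`, with the trace of `h`. -/
def surfaceWork {n : ℕ} {Ω : Set (Vec n)} (A : LipschitzBoundary Ω) (S₂ : Set (Vec n))
    (F h : Vec n → Vec n) : ℝ :=
  ∫ x in S₂, ∑ i, F x i * trace A (fun z => h z i) x ∂A.surfaceMeasure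

end

end ERFluid

/-!
Let `w = h - v`, and test the momentum equation with `w`. By Green's formula the work of `K` and
`F` against `w` is `2 ∫ φ ε(u) : ε(w)`: the pressure drops out because `div w = 0`, and only `S₂`
contributes to the boundary term because `w = 0` on `S₁`. The plastic part of the integrand is
`b / √I(u) · (ε(u) : ε(ũ + h) - I(u))`, which Cauchy–Schwarz bounds by `b (√I(ũ + h) - √I(u))`; this
yields the two values of `J`, and the `ψ`-part is `L`.

Green's formula rests on the divergence theorem. Above the graph of a Lipschitz function the shear
that flattens the graph preserves volume; in the new coordinates the integrals of tangential
derivatives vanish and those of vertical derivatives leave the boundary value. Each chart thus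
represents the distributional gradient of the indicator of `Ω` by a vector measure `ν ds`, so two
charts give the same measure on their overlap, and a partition of unity globalizes the formula.
-/

namespace ERFluid

/-! ### The divergence theorem above a Lipschitz graph -/

section Graph

theorem integrable_fderiv_apply {F : Type*} [NormedAddCommGroup F] [NormedSpace ℝ F]
    [MeasurableSpace F] [OpensMeasurableSpace F] {ν : Measure F} [IsFiniteMeasureOnCompacts ν]
    {G : F → ℝ} (hG : ContDiff ℝ 1 G) (hGc : HasCompactSupport G) {v : F → F} {M : ℝ}
    (hv : AEStronglyMeasurable v ν) (hM : ∀ z, ‖v z‖ ≤ M) :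
    Integrable (fun z => fderiv ℝ G z (v z)) ν := by
  have hG' : Integrable (fderiv ℝ G) ν :=
    (hG.continuous_fderiv one_ne_zero).integrable_of_hasCompactSupport (hGc.fderiv ℝ)
  refine (hG'.norm.mul_const M).mono'
    (isBoundedBilinearMap_apply.continuous.comp_aestronglyMeasurable₂ hG'.1 hv)
    (ae_of_all _ fun z => ?_)
  exact ((fderiv ℝ G z).le_opNorm _).trans (by gcongr; exact hM z)

variable {E : Type*} [NormedAddCommGroup E] [NormedSpace ℝ E] {γ : E → ℝ} {K : ℝ≥0} {G : E × ℝ → ℝ}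

theorem norm_fderiv_apply_le_of_lipschitz (hγ : LipschitzWith K γ) (y a : E) :
    ‖fderiv ℝ γ y a‖ ≤ K * ‖a‖ :=
  (fderiv ℝ γ y).le_of_opNorm_le (norm_fderiv_le_of_lipschitz ℝ hγ) a

theorem integral_Ioi_fderiv_vertical (hG : ContDiff ℝ 1 G) (hGc : HasCompactSupport G)
    (y : E) (r : ℝ) : ∫ t in Ioi 0, fderiv ℝ G (y, r + t) (0, 1) = -G (y, r) := by
  have hf : ContDiff ℝ 1 fun t : ℝ => G (y, r + t) := hG.comp (by fun_prop)
  have hfc : HasCompactSupport fun t : ℝ => G (y, r + t) := by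
    refine HasCompactSupport.intro
      ((hGc.isCompact.image continuous_snd).image (continuous_sub_right r)) fun t ht => ?_
    by_contra h
    exact ht ⟨_, ⟨_, subset_tsupport _ h, rfl⟩, by simp⟩
  have hd (t : ℝ) : deriv (fun t : ℝ => G (y, r + t)) t = fderiv ℝ G (y, r + t) (0, 1) :=
    (((hG.differentiable one_ne_zero) (y, r + t)).hasFDerivAt.comp_hasDerivAt t
      ((hasDerivAt_const t y).prodMk ((hasDerivAt_id t).const_add r))).deriv
  simpa only [hd, add_zero] using hfc.integral_Ioi_deriv_eq hf 0

variable [FiniteDimensional ℝ E] [MeasurableSpace E] [BorelSpace E]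
  (μ : Measure E) [μ.IsAddHaarMeasure]

theorem integral_lineDeriv_eq_zero_of_lipschitz {f : E → ℝ} {C : ℝ≥0} (hf : LipschitzWith C f)
    (hfc : HasCompactSupport f) (a : E) : ∫ y, lineDeriv ℝ f y a ∂μ = 0 := by
  have h := LipschitzWith.integral_lineDeriv_mul_eq (μ := μ) (LipschitzWith.const (1 : ℝ)) hf hfc
    (-a)
  simpa [lineDeriv] using h.symm

/-- The vertical shear `(y, t) ↦ (y, γ y + t)`, which maps the half space `t > 0` onto the region
above the graph of `γ`. -/
def verticalShear (hγ : Continuous γ) : (E × ℝ) ≃ₜ (E × ℝ) where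
  toFun z := (z.1, γ z.1 + z.2)
  invFun z := (z.1, z.2 - γ z.1)
  left_inv z := by simp
  right_inv z := by simp
  continuous_toFun := by fun_prop
  continuous_invFun := by fun_prop

theorem measurePreserving_verticalShear (hγ : Continuous γ) :
    MeasurePreserving (verticalShear hγ) (μ.prod volume) (μ.prod volume) := by
  refine (MeasurePreserving.id μ).skew_product (g := fun y t => γ y + t) ?_
    (ae_of_all _ fun y => (measurePreserving_add_left volume (γ y)).map_eq)
  exact (hγ.comp continuous_fst).measurable.add measurable_snd

theorem measurePreserving_verticalShear_restrict (hγ : Continuous γ) :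
    MeasurePreserving (verticalShear hγ) (μ.prod (volume.restrict (Ioi 0)))
      ((μ.prod volume).restrict {z | γ z.1 < z.2}) := by
  have hpre : verticalShear hγ ⁻¹' {z | γ z.1 < z.2} = univ ×ˢ Ioi (0 : ℝ) := by
    ext z
    simp [verticalShear]
  have h := (measurePreserving_verticalShear μ hγ).restrict_preimage_emb
    (verticalShear hγ).toMeasurableEquiv.measurableEmbedding {z | γ z.1 < z.2}
  rwa [hpre, ← Measure.prod_restrict, Measure.restrict_univ] at h

theorem integrable_comp_verticalShear {f : E × ℝ → ℝ} (hγ : Continuous γ)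
    (hf : Integrable f (μ.prod volume)) :
    Integrable (fun z : E × ℝ => f (z.1, γ z.1 + z.2)) (μ.prod (volume.restrict (Ioi 0))) :=
  (measurePreserving_verticalShear_restrict μ hγ).integrable_comp_of_integrable hf.restrict

theorem setIntegral_above_graph_eq {f : E × ℝ → ℝ} (hγ : Continuous γ) :
    ∫ z in {z | γ z.1 < z.2}, f z ∂μ.prod volume =
      ∫ z, f (z.1, γ z.1 + z.2) ∂μ.prod (volume.restrict (Ioi 0)) :=
  ((measurePreserving_verticalShear_restrict μ hγ).integral_comp
    (verticalShear hγ).toMeasurableEquiv.measurableEmbedding f).symm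

theorem integral_fderiv_tangential_eq_zero (hγ : LipschitzWith K γ) (hG : ContDiff ℝ 1 G)
    (hGc : HasCompactSupport G) (a : E) (t : ℝ) :
    ∫ y, fderiv ℝ G (y, γ y + t) (a, fderiv ℝ γ y a) ∂μ = 0 := by
  obtain ⟨C, hC⟩ := hG.lipschitzWith_of_hasCompactSupport hGc one_ne_zero
  have hlip := hC.comp (LipschitzWith.id.prodMk (hγ.add (LipschitzWith.const t)))
  have hsupp : HasCompactSupport fun y => G (y, γ y + t) := by
    refine HasCompactSupport.intro (hGc.isCompact.image continuous_fst) fun y hy => ?_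
    by_contra h
    exact hy ⟨_, subset_tsupport _ h, rfl⟩
  rw [← integral_lineDeriv_eq_zero_of_lipschitz μ hlip hsupp a]
  refine integral_congr_ae ?_
  filter_upwards [hγ.ae_differentiableAt (μ := μ)] with y hy
  have hd : HasFDerivAt (fun y => G (y, γ y + t))
      ((fderiv ℝ G (y, γ y + t)).comp ((ContinuousLinearMap.id ℝ E).prod (fderiv ℝ γ y))) y :=
    ((hG.differentiable one_ne_zero) (y, γ y + t)).hasFDerivAt.comp y
      ((hasFDerivAt_id y).prodMk (hy.hasFDerivAt.add_const t))
  exact (hd.hasLineDerivAt a).lineDeriv.symm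

theorem setIntegral_fderiv_above_graph (hγ : LipschitzWith K γ) (hG : ContDiff ℝ 1 G)
    (hGc : HasCompactSupport G) (a : E) (s : ℝ) :
    ∫ z in {z | γ z.1 < z.2}, fderiv ℝ G z (a, s) ∂μ.prod volume =
      ∫ y, G (y, γ y) * (fderiv ℝ γ y a - s) ∂μ := by
  have hmeas : Measurable fun z : E × ℝ => fderiv ℝ γ z.1 a :=
    (measurable_fderiv_apply_const ℝ γ a).comp measurable_fst
  have htang : Integrable (fun z => fderiv ℝ G z (a, fderiv ℝ γ z.1 a)) (μ.prod volume) :=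
    integrable_fderiv_apply hG hGc (M := max ‖a‖ (K * ‖a‖))
      (measurable_const.prodMk hmeas).aestronglyMeasurable
      fun z => max_le_max le_rfl (norm_fderiv_apply_le_of_lipschitz hγ z.1 a)
  have hall : Integrable (fun z => fderiv ℝ G z (a, s)) (μ.prod volume) :=
    integrable_fderiv_apply hG hGc aestronglyMeasurable_const fun _ => le_rfl
  have hdecomp (z : E × ℝ) : fderiv ℝ G z (a, s) - fderiv ℝ G z (a, fderiv ℝ γ z.1 a) =
      (s - fderiv ℝ γ z.1 a) * fderiv ℝ G z (0, 1) := by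
    rw [← map_sub, ← smul_eq_mul, ← map_smul]
    simp
  have hvert : Integrable (fun z => (s - fderiv ℝ γ z.1 a) * fderiv ℝ G z (0, 1))
      (μ.prod volume) := (hall.sub htang).congr (ae_of_all _ hdecomp)
  have hzero : ∫ z in {z | γ z.1 < z.2}, fderiv ℝ G z (a, fderiv ℝ γ z.1 a) ∂μ.prod volume = 0 := by
    rw [setIntegral_above_graph_eq μ hγ.continuous,
      integral_prod_symm _ (integrable_comp_verticalShear μ hγ.continuous htang)]
    simp only [integral_fderiv_tangential_eq_zero μ hγ hG hGc, integral_zero]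
  calc ∫ z in {z | γ z.1 < z.2}, fderiv ℝ G z (a, s) ∂μ.prod volume
      = ∫ z in {z | γ z.1 < z.2}, (s - fderiv ℝ γ z.1 a) * fderiv ℝ G z (0, 1) ∂μ.prod volume := by
        rw [← sub_zero (∫ z in _, _ ∂_), ← hzero,
          ← integral_sub hall.integrableOn htang.integrableOn]
        simp only [hdecomp]
    _ = ∫ y, (s - fderiv ℝ γ y a) * (∫ t in Ioi 0, fderiv ℝ G (y, γ y + t) (0, 1)) ∂μ := by
        rw [setIntegral_above_graph_eq μ hγ.continuous,
          integral_prod _ (integrable_comp_verticalShear μ hγ.continuous hvert)]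
        simp only [integral_const_mul]
    _ = ∫ y, G (y, γ y) * (fderiv ℝ γ y a - s) ∂μ := by
        simp only [integral_Ioi_fderiv_vertical hG hGc]
        exact integral_congr_ae (ae_of_all _ fun y => by ring)

end Graph

/-! ### Flux through the graph of a chart -/

section VectorMeasures

variable {F : Type*} [NormedAddCommGroup F] [MeasurableSpace F] [BorelSpace F]

theorem locallyIntegrable_rnDeriv_mul [LocallyCompactSpace F] {μ m : Measure F}
    [μ.HaveLebesgueDecomposition m] [SigmaFinite μ] (hμ : μ ≪ m) {a : F → ℝ}
    (ha : LocallyIntegrable a μ) :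
    LocallyIntegrable (fun x => (μ.rnDeriv m x).toReal * a x) m := by
  refine locallyIntegrable_iff.2 fun B hB => ?_
  rw [← integrable_indicator_iff hB.measurableSet]
  have hB' : Integrable (B.indicator a) μ :=
    (ha.integrableOn_isCompact hB).integrable_indicator hB.measurableSet
  refine ((integrable_rnDeriv_smul_iff hμ).2 hB').congr (ae_of_all _ fun x => ?_)
  by_cases hx : x ∈ B <;> simp [hx]

theorem integral_mul_eq_of_forall_integral_contDiff_mul_eq [NormedSpace ℝ F]
    [FiniteDimensional ℝ F] {μ ν : Measure F} [IsFiniteMeasureOnCompacts μ]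
    [IsFiniteMeasureOnCompacts ν] {a b : F → ℝ} (ha : LocallyIntegrable a μ)
    (hb : LocallyIntegrable b ν) {U : Set F} (hU : IsOpen U)
    (h : ∀ φ : F → ℝ, ContDiff ℝ ∞ φ → HasCompactSupport φ → tsupport φ ⊆ U →
      ∫ x, φ x * a x ∂μ = ∫ x, φ x * b x ∂ν)
    {g : F → ℝ} (hg : ∀ x ∉ U, g x = 0) : ∫ x, g x * a x ∂μ = ∫ x, g x * b x ∂ν := by
  set m := μ + ν
  have : IsFiniteMeasureOnCompacts m :=
    ⟨fun B hB => by simpa [m] using ⟨hB.measure_lt_top, hB.measure_lt_top⟩⟩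
  have hμ : μ ≪ m := (Measure.le_add_right le_rfl).absolutelyContinuous
  have hν : ν ≪ m := (Measure.le_add_left le_rfl).absolutelyContinuous
  have hμm (f : F → ℝ) :
      ∫ x, f x * ((μ.rnDeriv m x).toReal * a x) ∂m = ∫ x, f x * a x ∂μ := by
    simpa only [smul_eq_mul, mul_left_comm] using
      integral_rnDeriv_smul hμ (f := fun x => f x * a x)
  have hνm (f : F → ℝ) :
      ∫ x, f x * ((ν.rnDeriv m x).toReal * b x) ∂m = ∫ x, f x * b x ∂ν := by
    simpa only [smul_eq_mul, mul_left_comm] using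
      integral_rnDeriv_smul hν (f := fun x => f x * b x)
  have ha' := locallyIntegrable_rnDeriv_mul hμ ha
  have hb' := locallyIntegrable_rnDeriv_mul hν hb
  have hae := hU.ae_eq_zero_of_integral_contDiff_smul_eq_zero
    ((ha'.sub hb').locallyIntegrableOn U) fun φ hφ hφc hφU => by
      simp only [Pi.sub_apply, smul_sub]
      rw [integral_sub (ha'.integrable_smul_left_of_hasCompactSupport hφ.continuous hφc)
        (hb'.integrable_smul_left_of_hasCompactSupport hφ.continuous hφc)]
      simp only [smul_eq_mul]
      rw [hμm, hνm, h φ hφ hφc hφU, sub_self]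
  rw [← hμm, ← hνm]
  refine integral_congr_ae ?_
  filter_upwards [hae] with x hx
  by_cases hxU : x ∈ U
  · exact congrArg (g x * ·) (sub_eq_zero.1 (hx hxU))
  · simp only [hg x hxU, zero_mul]

end VectorMeasures

variable {n : ℕ} {Ω : Set (Vec n)}

namespace LipschitzChart

variable (c : LipschitzChart n)

theorem continuous_γ : Continuous c.γ :=
  c.lipschitz.choose_spec.continuous

theorem continuous_graphMap : Continuous c.graphMap := by
  have := c.continuous_γ
  unfold graphMap
  fun_prop

theorem measurable_gradient : Measurable (gradient c.γ) :=
  ((InnerProductSpace.toDual ℝ (Vec (n - 1))).symm.continuous.measurable).comp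
    (measurable_fderiv ℝ c.γ)

theorem measurable_areaElement : Measurable c.areaElement := by
  have := c.measurable_gradient
  unfold areaElement
  fun_prop

theorem areaElement_pos (y : Vec (n - 1)) : 0 < c.areaElement y :=
  Real.sqrt_pos.2 (by positivity)

theorem exists_areaElement_le : ∃ C : ℝ, ∀ y, c.areaElement y ≤ C := by
  obtain ⟨K, hK⟩ := c.lipschitz
  refine ⟨Real.sqrt (1 + (K : ℝ) ^ 2), fun y => Real.sqrt_le_sqrt ?_⟩
  have : ‖gradient c.γ y‖ ≤ K := by
    rw [gradient, LinearIsometryEquiv.norm_map]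
    exact norm_fderiv_le_of_lipschitz ℝ hK
  gcongr

theorem measurable_graphNormal_apply (i : Fin n) : Measurable fun x => c.graphNormal x i := by
  have hy : Measurable fun x : Vec n => (c.frame.symm x).fst :=
    Continuous.measurable (by fun_prop)
  have hframe : Measurable fun q : Vec (n - 1) × ℝ => c.frame (WithLp.toLp 2 q) i :=
    Continuous.measurable (by fun_prop)
  exact (c.measurable_areaElement.comp hy).inv.mul
    (hframe.comp ((c.measurable_gradient.comp hy).prodMk measurable_const))

theorem norm_graphNormal (x : Vec n) : ‖c.graphNormal x‖ = 1 := by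
  set y := (c.frame.symm x).fst
  have hnorm : ‖c.frame (WithLp.toLp 2 (gradient c.γ y, (-1 : ℝ)))‖ = c.areaElement y := by
    rw [LinearIsometryEquiv.norm_map, WithLp.prod_norm_eq_of_L2, areaElement, add_comm]
    simp
  rw [graphNormal, norm_smul, hnorm, norm_inv, Real.norm_of_nonneg (c.areaElement_pos y).le,
    inv_mul_cancel₀ (c.areaElement_pos y).ne']

instance isFiniteMeasureOnCompacts_graphMeasure : IsFiniteMeasureOnCompacts c.graphMeasure := by
  refine ⟨fun B hB => ?_⟩
  obtain ⟨C, hC⟩ := c.exists_areaElement_le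
  have hpre : MeasurableSet (c.graphMap ⁻¹' B) :=
    c.continuous_graphMap.measurable hB.measurableSet
  have hcont : Continuous fun x : Vec n => (c.frame.symm x).fst := by fun_prop
  have hsub : c.graphMap ⁻¹' B ⊆ (fun x : Vec n => (c.frame.symm x).fst) '' B := fun y hy =>
    ⟨_, hy, by simp [graphMap]⟩
  rw [graphMeasure, Measure.map_apply c.continuous_graphMap.measurable hB.measurableSet,
    withDensity_apply _ hpre]
  calc ∫⁻ y in c.graphMap ⁻¹' B, ENNReal.ofReal (c.areaElement y)
      ≤ ∫⁻ _ in c.graphMap ⁻¹' B, ENNReal.ofReal C :=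
        lintegral_mono fun y => ENNReal.ofReal_le_ofReal (hC y)
    _ = ENNReal.ofReal C * volume (c.graphMap ⁻¹' B) := setLIntegral_const _ _
    _ < ⊤ := ENNReal.mul_lt_top ENNReal.ofReal_lt_top
        ((measure_mono hsub).trans_lt (hB.image hcont).measure_lt_top)

theorem locallyIntegrable_graphNormal_apply (i : Fin n) :
    LocallyIntegrable (fun x => c.graphNormal x i) c.graphMeasure := by
  refine (locallyIntegrable_const (1 : ℝ)).mono
    (c.measurable_graphNormal_apply i).aestronglyMeasurable (ae_of_all _ fun x => ?_)
  rw [norm_one, ← c.norm_graphNormal x]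
  exact PiLp.norm_apply_le _ i

theorem integral_graphMeasure {f : Vec n → ℝ} (hf : Measurable f) :
    ∫ x, f x ∂c.graphMeasure = ∫ y, c.areaElement y * f (c.graphMap y) := by
  rw [graphMeasure, integral_map c.continuous_graphMap.aemeasurable hf.aestronglyMeasurable,
    integral_withDensity_eq_integral_toReal_smul c.measurable_areaElement.ennreal_ofReal
      (ae_of_all _ fun _ => ENNReal.ofReal_lt_top)]
  simp only [ENNReal.toReal_ofReal (c.areaElement_pos _).le, smul_eq_mul]

theorem measurePreserving_frame :
    MeasurePreserving (fun z : Vec (n - 1) × ℝ => c.frame (WithLp.toLp 2 z)) volume volume :=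
  c.frame.measurePreserving.comp (WithLp.volume_preserving_toLp (Vec (n - 1)) ℝ)

theorem areaElement_mul_graphNormal_apply (y : Vec (n - 1)) (i : Fin n) :
    c.areaElement y * c.graphNormal (c.graphMap y) i =
      fderiv ℝ c.γ y (c.frame.symm (basisVec i)).fst - (c.frame.symm (basisVec i)).snd := by
  have hnormal : c.graphNormal (c.graphMap y) =
      (c.areaElement y)⁻¹ • c.frame (WithLp.toLp 2 (gradient c.γ y, (-1 : ℝ))) := by
    simp [graphNormal, graphMap]
  have hcoord (z : Vec n) : z i = inner ℝ z (basisVec i) := by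
    simp [basisVec, EuclideanSpace.inner_single_right]
  rw [hnormal, PiLp.smul_apply, smul_eq_mul, mul_inv_cancel_left₀ (c.areaElement_pos y).ne', hcoord,
    LinearIsometryEquiv.inner_map_eq_flip, WithLp.prod_inner_apply]
  simp [gradient, InnerProductSpace.toDual_symm_apply, sub_eq_add_neg]

theorem setIntegral_epigraph_fderiv {g : Vec n → ℝ} (hg : ContDiff ℝ 1 g)
    (hgc : HasCompactSupport g) (i : Fin n) :
    ∫ x in c.epigraph, fderiv ℝ g x (basisVec i) =
      ∫ x, g x * c.graphNormal x i ∂c.graphMeasure := by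
  obtain ⟨K, hK⟩ := c.lipschitz
  set a := (c.frame.symm (basisVec i)).fst
  set s := (c.frame.symm (basisVec i)).snd
  let e : (Vec (n - 1) × ℝ) ≃L[ℝ] Vec n :=
    (WithLp.prodContinuousLinearEquiv 2 ℝ (Vec (n - 1)) ℝ).symm.trans
      c.frame.toContinuousLinearEquiv
  have hepi : e ⁻¹' c.epigraph = {z | c.γ z.1 < z.2} := by
    ext z
    simp [e, epigraph]
  have hderiv (z : Vec (n - 1) × ℝ) :
      fderiv ℝ (g ∘ e) z (a, s) = fderiv ℝ g (e z) (basisVec i) := by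
    rw [fderiv_comp z (hg.differentiable one_ne_zero _) e.differentiableAt,
      ContinuousLinearEquiv.fderiv, ContinuousLinearMap.comp_apply]
    exact congrArg _ (c.frame.apply_symm_apply (basisVec i))
  have hmp : MeasurePreserving e (volume.prod volume) volume := c.measurePreserving_frame
  calc ∫ x in c.epigraph, fderiv ℝ g x (basisVec i)
      = ∫ z in {z | c.γ z.1 < z.2}, fderiv ℝ (g ∘ e) z (a, s) ∂volume.prod volume := by
        rw [← hmp.setIntegral_preimage_emb e.toHomeomorph.toMeasurableEquiv.measurableEmbedding,
          hepi]
        simp only [hderiv]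
    _ = ∫ y, g (c.graphMap y) * (fderiv ℝ c.γ y a - s) :=
        setIntegral_fderiv_above_graph volume hK (hg.comp e.contDiff)
          (hgc.comp_homeomorph e.toHomeomorph) a s
    _ = ∫ x, g x * c.graphNormal x i ∂c.graphMeasure := by
        have hmeas : Measurable fun x => g x * c.graphNormal x i :=
          hg.continuous.measurable.mul (c.measurable_graphNormal_apply i)
        rw [c.integral_graphMeasure hmeas]
        simp only [mul_left_comm (c.areaElement _), areaElement_mul_graphNormal_apply, a, s]

theorem ae_mem_graph :
    ∀ᵐ x ∂c.graphMeasure, c.γ (c.frame.symm x).fst = (c.frame.symm x).snd := by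
  have hγ := c.continuous_γ
  have hcl : IsClosed {x : Vec n | c.γ (c.frame.symm x).fst = (c.frame.symm x).snd} :=
    isClosed_eq (by fun_prop) (by fun_prop)
  rw [graphMeasure, ae_map_iff c.continuous_graphMap.aemeasurable hcl.measurableSet]
  exact ae_of_all _ fun y => by simp [graphMap]

theorem isOpen_epigraph : IsOpen c.epigraph := by
  have hγ := c.continuous_γ
  exact isOpen_lt (by fun_prop) (by fun_prop)

theorem mem_closure_epigraph_of_mem_graph {x : Vec n}
    (hx : c.γ (c.frame.symm x).fst = (c.frame.symm x).snd) : x ∈ closure c.epigraph := by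
  let z : ℝ → Vec n := fun s =>
    c.frame (WithLp.toLp 2 ((c.frame.symm x).fst, (c.frame.symm x).snd + s))
  have hz0 : z 0 = x := by
    simp only [z, add_zero]
    exact c.frame.apply_symm_apply x
  have hz : Tendsto z (𝓝[>] 0) (𝓝 x) :=
    hz0 ▸ (Continuous.tendsto (by fun_prop) 0).mono_left nhdsWithin_le_nhds
  refine mem_closure_of_tendsto hz ?_
  filter_upwards [self_mem_nhdsWithin] with s hs
  have hs : 0 < s := hs
  simp [epigraph, z, hx, hs]

theorem mem_frontier_of_mem_graph (hΩ : IsOpen Ω) (hc : Ω ∩ c.U = c.epigraph ∩ c.U) {x : Vec n}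
    (hxU : x ∈ c.U) (hx : c.γ (c.frame.symm x).fst = (c.frame.symm x).snd) : x ∈ frontier Ω := by
  have hcl : x ∈ closure (Ω ∩ c.U) := by
    rw [hc, inter_comm]
    exact c.isOpen_U.inter_closure ⟨hxU, c.mem_closure_epigraph_of_mem_graph hx⟩
  rw [hΩ.frontier_eq]
  refine ⟨closure_mono inter_subset_left hcl, fun hxΩ => ?_⟩
  exact ((hc.subset ⟨hxΩ, hxU⟩).1 : c.γ (c.frame.symm x).fst < (c.frame.symm x).snd).ne hx

theorem ae_mem_frontier (hΩ : IsOpen Ω) (hc : Ω ∩ c.U = c.epigraph ∩ c.U) :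
    ∀ᵐ x ∂c.graphMeasure, x ∈ c.U → x ∈ frontier Ω := by
  filter_upwards [c.ae_mem_graph] with x hx hU
  exact c.mem_frontier_of_mem_graph hΩ hc hU hx

theorem setIntegral_fderiv (hΩ : IsOpen Ω) (hc : Ω ∩ c.U = c.epigraph ∩ c.U) {g : Vec n → ℝ}
    (hg : ContDiff ℝ 1 g) (hgc : HasCompactSupport g) (hgU : tsupport g ⊆ c.U) (i : Fin n) :
    ∫ x in Ω, fderiv ℝ g x (basisVec i) = ∫ x, g x * c.graphNormal x i ∂c.graphMeasure := by
  have hzero (x : Vec n) (hx : x ∉ c.U) : fderiv ℝ g x (basisVec i) = 0 := by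
    rw [fderiv_of_notMem_tsupport ℝ fun h => hx (hgU h), zero_apply]
  have hinter {s : Set (Vec n)} (hs : IsOpen s) :
      ∫ x in s, fderiv ℝ g x (basisVec i) = ∫ x in s ∩ c.U, fderiv ℝ g x (basisVec i) :=
    setIntegral_eq_of_subset_of_forall_sdiff_eq_zero hs.measurableSet inter_subset_left
      fun x hx => hzero x fun hU => hx.2 ⟨hx.1, hU⟩
  rw [← c.setIntegral_epigraph_fderiv hg hgc i, hinter hΩ, hc, ← hinter c.isOpen_epigraph]

/-- Both vector measures `ν ds` represent the distributional gradient of the indicator function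
of `Ω`, so they agree where the charts overlap. -/
theorem integral_mul_graphNormal_eq (c d : LipschitzChart n) (hΩ : IsOpen Ω)
    (hc : Ω ∩ c.U = c.epigraph ∩ c.U) (hd : Ω ∩ d.U = d.epigraph ∩ d.U)
    {g : Vec n → ℝ} (hg : ∀ x ∉ c.U ∩ d.U, g x = 0) (i : Fin n) :
    ∫ x, g x * c.graphNormal x i ∂c.graphMeasure =
      ∫ x, g x * d.graphNormal x i ∂d.graphMeasure := by
  refine integral_mul_eq_of_forall_integral_contDiff_mul_eq
    (c.locallyIntegrable_graphNormal_apply i) (d.locallyIntegrable_graphNormal_apply i)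
    (c.isOpen_U.inter d.isOpen_U) (fun φ hφ hφc hφU => ?_) hg
  have hφ1 : ContDiff ℝ 1 φ := hφ.of_le (mod_cast le_top)
  rw [← c.setIntegral_fderiv hΩ hc hφ1 hφc (hφU.trans inter_subset_left),
    ← d.setIntegral_fderiv hΩ hd hφ1 hφc (hφU.trans inter_subset_right)]

end LipschitzChart

/-! ### The divergence theorem in a bounded Lipschitz domain -/

section NormedSpace

variable {F : Type*} [NormedAddCommGroup F] [NormedSpace ℝ F] [FiniteDimensional ℝ F]

theorem setIntegral_fderiv_eq_zero_of_tsupport_subset [MeasurableSpace F] [BorelSpace F]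
    {μ : Measure F} [μ.IsAddHaarMeasure] {s : Set F} {g : F → ℝ} (hg : ContDiff ℝ 1 g)
    (hgc : HasCompactSupport g) (hgs : tsupport g ⊆ s) (a : F) :
    ∫ x in s, fderiv ℝ g x a ∂μ = 0 := by
  obtain ⟨C, hC⟩ := hg.lipschitzWith_of_hasCompactSupport hgc one_ne_zero
  have hzero (x : F) (hx : x ∉ s) : fderiv ℝ g x a = 0 := by
    rw [fderiv_of_notMem_tsupport ℝ fun h => hx (hgs h), zero_apply]
  rw [setIntegral_eq_integral_of_forall_compl_eq_zero hzero,
    ← integral_lineDeriv_eq_zero_of_lipschitz μ hC hgc a]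
  simp only [(hg.differentiable one_ne_zero _).lineDeriv_eq_fderiv]

theorem exists_contDiff_hasCompactSupport_sum_eq {ι : Type*} [Fintype ι] {s : Set F}
    (hs : IsCompact s) {U : ι → Set F} (hU : ∀ i, IsOpen (U i)) (hsU : s ⊆ ⋃ i, U i) {m : ℕ∞}
    {f : F → ℝ} (hf : ContDiff ℝ m f) :
    ∃ g : ι → F → ℝ, (∀ i, ContDiff ℝ m (g i)) ∧ (∀ i, HasCompactSupport (g i)) ∧
      (∀ i, tsupport (g i) ⊆ U i) ∧ ∀ x ∈ s, ∑ i, g i x = f x := by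
  have := FiniteDimensional.proper_real F
  obtain ⟨R, hR⟩ := hs.isBounded.subset_ball (0 : F)
  obtain ⟨χ, hχ⟩ := SmoothPartitionOfUnity.exists_isSubordinate (modelWithCornersSelf ℝ F)
    hs.isClosed (fun i => U i ∩ Metric.ball 0 R) (fun i => (hU i).inter Metric.isOpen_ball)
    (by rw [← iUnion_inter]; exact subset_inter hsU hR)
  refine ⟨fun i x => χ i x * f x, fun i => ?_, fun i => ?_, fun i => ?_, fun x hx => ?_⟩
  · exact ((χ i).contMDiff.contDiff.of_le (mod_cast le_top)).mul hf
  · refine HasCompactSupport.mul_right ((isCompact_closedBall (0 : F) R).of_isClosed_subset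
      (isClosed_tsupport _) ?_)
    exact (hχ i).trans (inter_subset_right.trans Metric.ball_subset_closedBall)
  · exact tsupport_mul_subset_left.trans ((hχ i).trans inter_subset_left)
  · rw [← Finset.sum_mul, ← finsum_eq_sum_of_fintype, χ.sum_eq_one hx, one_mul]

end NormedSpace

theorem memLp_of_continuous_of_ae_mem_isCompact {α : Type*} [TopologicalSpace α]
    [MeasurableSpace α] [OpensMeasurableSpace α] {μ : Measure α} [IsFiniteMeasureOnCompacts μ]
    {s : Set α} (hs : IsCompact s) (hμs : ∀ᵐ x ∂μ, x ∈ s) {f : α → ℝ} (hf : Continuous f)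
    (p : ℝ≥0∞) : MemLp f p μ := by
  have : IsFiniteMeasure μ :=
    ⟨by rw [← measure_congr (eventuallyEq_univ.2 hμs)]; exact hs.measure_lt_top⟩
  obtain ⟨C, hC⟩ := hs.exists_bound_of_continuousOn hf.continuousOn
  exact MemLp.of_bound hf.aestronglyMeasurable C (hμs.mono hC)

namespace LipschitzBoundary

variable (A : LipschitzBoundary Ω)

theorem piece_eq_disjointed : A.piece = disjointed fun k => (A.chart k).U := by
  ext k x
  simp [piece, disjointed, Finset.sup_set_eq_biUnion]

theorem measurableSet_piece (k : Fin A.N) : MeasurableSet (A.piece k) :=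
  (A.chart k).isOpen_U.measurableSet.diff (MeasurableSet.iUnion fun l =>
    MeasurableSet.iUnion fun _ => (A.chart l).isOpen_U.measurableSet)

theorem piece_subset (k : Fin A.N) : A.piece k ⊆ (A.chart k).U := sdiff_subset

theorem pairwise_disjoint_piece : Pairwise (Function.onFun Disjoint A.piece) := by
  rw [piece_eq_disjointed]
  exact disjoint_disjointed _

theorem iUnion_piece : ⋃ k, A.piece k = ⋃ k, (A.chart k).U := by
  rw [piece_eq_disjointed, iUnion_disjointed]

theorem exists_mem_piece {x : Vec n} (hx : x ∈ frontier Ω) : ∃ k, x ∈ A.piece k :=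
  mem_iUnion.1 (A.iUnion_piece ▸ A.cover hx)

theorem normal_of_mem_piece {k : Fin A.N} {x : Vec n} (hx : x ∈ A.piece k) :
    A.normal x = (A.chart k).graphNormal x := by
  rw [normal, Finset.sum_eq_single k (fun l _ hl => ?_) (by simp), indicator_of_mem hx]
  exact indicator_of_notMem (fun hxl => disjoint_left.1 (A.pairwise_disjoint_piece hl) hxl hx) _

theorem measurable_normal_apply (i : Fin n) : Measurable fun x => A.normal x i := by
  have h (x : Vec n) : A.normal x i =
      ∑ k, (A.piece k).indicator (fun x => (A.chart k).graphNormal x i) x := by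
    rw [normal, WithLp.ofLp_sum, Finset.sum_apply]
    exact Finset.sum_congr rfl fun k _ => by by_cases hx : x ∈ A.piece k <;> simp [hx]
  simp only [h]
  exact Finset.measurable_fun_sum _ fun k _ =>
    ((A.chart k).measurable_graphNormal_apply i).indicator (A.measurableSet_piece k)

theorem ae_mem_frontier (hΩ : IsOpen Ω) : ∀ᵐ x ∂A.surfaceMeasure, x ∈ frontier Ω := by
  rw [surfaceMeasure, Measure.ae_sum_iff]
  intro k
  rw [ae_restrict_iff' (A.measurableSet_piece k)]
  filter_upwards [(A.chart k).ae_mem_frontier hΩ (A.eq_epigraph k)] with x hx hp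
  exact hx (A.piece_subset k hp)

theorem ae_norm_normal_apply_le (hΩ : IsOpen Ω) (i : Fin n) :
    ∀ᵐ x ∂A.surfaceMeasure, ‖A.normal x i‖ ≤ 1 := by
  filter_upwards [A.ae_mem_frontier hΩ] with x hx
  obtain ⟨k, hk⟩ := A.exists_mem_piece hx
  rw [A.normal_of_mem_piece hk, ← (A.chart k).norm_graphNormal x]
  exact PiLp.norm_apply_le _ i

instance isFiniteMeasureOnCompacts_surfaceMeasure :
    IsFiniteMeasureOnCompacts A.surfaceMeasure := by
  refine ⟨fun B hB => ?_⟩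
  rw [surfaceMeasure, Measure.sum_apply _ hB.measurableSet, tsum_fintype]
  exact ENNReal.sum_lt_top.2 fun k _ => (Measure.restrict_apply_le _ _).trans_lt hB.measure_lt_top

theorem memLp_of_continuous (hΩ : IsOpen Ω) (hΩb : Bornology.IsBounded Ω) {f : Vec n → ℝ}
    (hf : Continuous f) (p : ℝ≥0∞) : MemLp f p A.surfaceMeasure :=
  memLp_of_continuous_of_ae_mem_isCompact (hΩb.isCompact_closure.of_isClosed_subset
    isClosed_frontier frontier_subset_closure) (A.ae_mem_frontier hΩ) hf p

variable {A}

theorem memLp_mul_normal (hΩ : IsOpen Ω) {f : Vec n → ℝ} {p : ℝ≥0∞}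
    (hf : MemLp f p A.surfaceMeasure) (i : Fin n) :
    MemLp (fun x => f x * A.normal x i) p A.surfaceMeasure := by
  refine hf.mono (hf.1.mul (A.measurable_normal_apply i).aestronglyMeasurable) ?_
  filter_upwards [A.ae_norm_normal_apply_le hΩ i] with x hx
  rw [norm_mul]
  exact mul_le_of_le_one_right (norm_nonneg _) hx

theorem integrable_mul_normal (hΩ : IsOpen Ω) (hΩb : Bornology.IsBounded Ω) {f : Vec n → ℝ}
    (hf : Continuous f) (i : Fin n) :
    Integrable (fun x => f x * A.normal x i) A.surfaceMeasure :=
  memLp_one_iff_integrable.1 (memLp_mul_normal hΩ (A.memLp_of_continuous hΩ hΩb hf 1) i)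

theorem setIntegral_piece_mul_normal (hΩ : IsOpen Ω) {g : Vec n → ℝ} {k : Fin A.N}
    (hg : ∀ x ∉ (A.chart k).U, g x = 0) (l : Fin A.N) (i : Fin n) :
    ∫ x in A.piece l, g x * A.normal x i ∂(A.chart l).graphMeasure =
      ∫ x in A.piece l, g x * (A.chart k).graphNormal x i ∂(A.chart k).graphMeasure := by
  have hzero (x : Vec n) (hx : x ∉ (A.chart l).U ∩ (A.chart k).U) :
      (A.piece l).indicator g x = 0 := by
    by_cases hxl : x ∈ A.piece l
    · rw [indicator_of_mem hxl, hg x fun hxk => hx ⟨A.piece_subset l hxl, hxk⟩]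
    · exact indicator_of_notMem hxl _
  have hindicator (m : Fin A.N) :
      ∫ x in A.piece l, g x * (A.chart m).graphNormal x i ∂(A.chart m).graphMeasure =
        ∫ x, (A.piece l).indicator g x * (A.chart m).graphNormal x i
          ∂(A.chart m).graphMeasure := by
    rw [← integral_indicator (A.measurableSet_piece l)]
    simp only [indicator_mul_left]
  rw [hindicator k, ← (A.chart l).integral_mul_graphNormal_eq (A.chart k) hΩ (A.eq_epigraph l)
    (A.eq_epigraph k) hzero, ← hindicator l]
  refine setIntegral_congr_fun (A.measurableSet_piece l) fun x hx => ?_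
  simp only [A.normal_of_mem_piece hx]

theorem integral_mul_normal_eq_of_tsupport_subset (hΩ : IsOpen Ω) (hΩb : Bornology.IsBounded Ω)
    {g : Vec n → ℝ} (hg : Continuous g) (hgc : HasCompactSupport g) {k : Fin A.N}
    (hgU : tsupport g ⊆ (A.chart k).U) (i : Fin n) :
    ∫ x, g x * A.normal x i ∂A.surfaceMeasure =
      ∫ x, g x * (A.chart k).graphNormal x i ∂(A.chart k).graphMeasure := by
  have hzero (x : Vec n) (hx : x ∉ (A.chart k).U) : g x = 0 :=
    image_eq_zero_of_notMem_tsupport fun h => hx (hgU h)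
  have hint : Integrable (fun x => g x * (A.chart k).graphNormal x i) (A.chart k).graphMeasure :=
    ((A.chart k).locallyIntegrable_graphNormal_apply i).integrable_smul_left_of_hasCompactSupport
      hg hgc
  calc ∫ x, g x * A.normal x i ∂A.surfaceMeasure
      = ∑ l, ∫ x in A.piece l, g x * A.normal x i ∂(A.chart l).graphMeasure := by
        have hsum : Integrable (fun x => g x * A.normal x i) A.surfaceMeasure :=
          integrable_mul_normal hΩ hΩb hg i
        rw [surfaceMeasure] at hsum ⊢
        rw [integral_sum_measure hsum, tsum_fintype]
    _ = ∑ l, ∫ x in A.piece l, g x * (A.chart k).graphNormal x i ∂(A.chart k).graphMeasure := by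
        simp only [setIntegral_piece_mul_normal hΩ hzero]
    _ = ∫ x in ⋃ l, A.piece l, g x * (A.chart k).graphNormal x i ∂(A.chart k).graphMeasure :=
        (integral_iUnion_fintype A.measurableSet_piece A.pairwise_disjoint_piece
          fun _ => hint.integrableOn).symm
    _ = ∫ x, g x * (A.chart k).graphNormal x i ∂(A.chart k).graphMeasure := by
        refine setIntegral_eq_integral_of_forall_compl_eq_zero fun x hx => ?_
        rw [iUnion_piece] at hx
        rw [hzero x fun hk => hx (mem_iUnion_of_mem k hk), zero_mul]

variable (A)

theorem closure_subset_iUnion_option :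
    closure Ω ⊆ ⋃ o : Option (Fin A.N), o.elim Ω fun k => (A.chart k).U := by
  rw [iUnion_option, closure_eq_self_union_frontier]
  exact union_subset_union_right Ω A.cover

theorem setIntegral_fderiv (hΩ : IsOpen Ω) (hΩb : Bornology.IsBounded Ω) {f : Vec n → ℝ}
    (hf : ContDiff ℝ 1 f) (i : Fin n) :
    ∫ x in Ω, fderiv ℝ f x (basisVec i) = ∫ x, f x * A.normal x i ∂A.surfaceMeasure := by
  obtain ⟨g, hg, hgc, hgU, hsum⟩ := exists_contDiff_hasCompactSupport_sum_eq hΩb.isCompact_closure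
    (by rintro (_ | k); exacts [hΩ, (A.chart k).isOpen_U]) A.closure_subset_iUnion_option
    (m := 1) hf
  have hflux (o : Option (Fin A.N)) : ∫ x in Ω, fderiv ℝ (g o) x (basisVec i) =
      ∫ x, g o x * A.normal x i ∂A.surfaceMeasure := by
    rcases o with _ | k
    · have hgΩ : tsupport (g none) ⊆ Ω := hgU none
      rw [setIntegral_fderiv_eq_zero_of_tsupport_subset (hg none) (hgc none) hgΩ,
        integral_eq_zero_of_ae]
      filter_upwards [A.ae_mem_frontier hΩ] with x hx
      have hxΩ : x ∉ Ω := (hΩ.frontier_eq.subset hx).2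
      simp [image_eq_zero_of_notMem_tsupport fun h => hxΩ (hgΩ h)]
    · rw [integral_mul_normal_eq_of_tsupport_subset hΩ hΩb (hg _).continuous (hgc _) (hgU _),
        (A.chart k).setIntegral_fderiv hΩ (A.eq_epigraph k) (hg _) (hgc _) (hgU _)]
  have hderiv (x : Vec n) (hx : x ∈ Ω) :
      fderiv ℝ f x (basisVec i) = ∑ o, fderiv ℝ (g o) x (basisVec i) := by
    have heq : f =ᶠ[𝓝 x] fun z => ∑ o, g o z := by
      filter_upwards [hΩ.mem_nhds hx] with z hz using (hsum z (subset_closure hz)).symm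
    rw [heq.fderiv_eq, fderiv_fun_sum fun o _ => (hg o).differentiable one_ne_zero x, sum_apply]
  calc ∫ x in Ω, fderiv ℝ f x (basisVec i)
      = ∑ o, ∫ x in Ω, fderiv ℝ (g o) x (basisVec i) := by
        rw [setIntegral_congr_fun hΩ.measurableSet hderiv]
        exact integral_finsetSum _ fun o _ => (integrable_fderiv_apply (hg o) (hgc o)
          aestronglyMeasurable_const fun _ => le_rfl).integrableOn
    _ = ∑ o, ∫ x, g o x * A.normal x i ∂A.surfaceMeasure := Finset.sum_congr rfl fun o _ => hflux o
    _ = ∫ x, f x * A.normal x i ∂A.surfaceMeasure := by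
        rw [← integral_finsetSum _ fun o _ => integrable_mul_normal hΩ hΩb (hg o).continuous i]
        refine integral_congr_ae ?_
        filter_upwards [A.ae_mem_frontier hΩ] with x hx
        rw [← Finset.sum_mul, hsum x (frontier_subset_closure hx)]

end LipschitzBoundary

/-! ### Weak derivatives -/

section Lp

variable {α : Type*} [MeasurableSpace α] {μ : Measure α} {f g : α → ℝ} {F G : ℕ → α → ℝ}

theorem integrable_mul_of_memLp_two (hf : MemLp f 2 μ) (hg : MemLp g 2 μ) :
    Integrable (fun x => f x * g x) μ :=
  hf.integrable_mul hg

theorem tendsto_integral_mul_of_tendsto_eLpNorm (hf : MemLp f 2 μ) (hg : MemLp g 2 μ)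
    (hF : ∀ k, MemLp (F k) 2 μ) (hG : ∀ k, MemLp (G k) 2 μ)
    (hFf : Tendsto (fun k => eLpNorm (fun x => F k x - f x) 2 μ) atTop (𝓝 0))
    (hGg : Tendsto (fun k => eLpNorm (fun x => G k x - g x) 2 μ) atTop (𝓝 0)) :
    Tendsto (fun k => ∫ x, F k x * G k x ∂μ) atTop (𝓝 (∫ x, f x * g x ∂μ)) := by
  have hinner {a b : α → ℝ} (ha : MemLp a 2 μ) (hb : MemLp b 2 μ) :
      inner ℝ (ha.toLp a) (hb.toLp b) = ∫ x, a x * b x ∂μ := by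
    rw [L2.inner_def]
    refine integral_congr_ae ?_
    filter_upwards [ha.coeFn_toLp, hb.coeFn_toLp] with x hax hbx
    rw [hax, hbx, Real.inner_apply]
  simpa only [hinner] using
    ((Lp.tendsto_Lp_iff_tendsto_eLpNorm'' F hF f hf).2 hFf).inner (𝕜 := ℝ)
      ((Lp.tendsto_Lp_iff_tendsto_eLpNorm'' G hG g hg).2 hGg)

theorem tendsto_eLpNorm_linearComb {p : ℝ≥0∞} [Fact (1 ≤ p)] (c d : ℝ) (hf : MemLp f p μ)
    (hg : MemLp g p μ) (hF : ∀ k, MemLp (F k) p μ) (hG : ∀ k, MemLp (G k) p μ)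
    (hFf : Tendsto (fun k => eLpNorm (fun x => F k x - f x) p μ) atTop (𝓝 0))
    (hGg : Tendsto (fun k => eLpNorm (fun x => G k x - g x) p μ) atTop (𝓝 0)) :
    Tendsto (fun k => eLpNorm (fun x => (c * F k x + d * G k x) - (c * f x + d * g x)) p μ)
      atTop (𝓝 0) :=
  (Lp.tendsto_Lp_iff_tendsto_eLpNorm'' _ (fun k => ((hF k).const_smul c).add ((hG k).const_smul d))
    _ ((hf.const_smul c).add (hg.const_smul d))).1
    ((((Lp.tendsto_Lp_iff_tendsto_eLpNorm'' F hF f hf).2 hFf).const_smul c).add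
      (((Lp.tendsto_Lp_iff_tendsto_eLpNorm'' G hG g hg).2 hGg).const_smul d))

end Lp

theorem continuous_fderiv_basisVec {f : Vec n → ℝ} (hf : ContDiff ℝ ∞ f) (i : Fin n) :
    Continuous fun x => fderiv ℝ f x (basisVec i) :=
  (hf.continuous_fderiv (by simp)).clm_apply continuous_const

theorem isWeakPartial_fderiv {z : Vec n → ℝ} (hz : ContDiff ℝ ∞ z) (i : Fin n) :
    IsWeakPartial Ω z i fun x => fderiv ℝ z x (basisVec i) := by
  intro φ hφ hφc hφΩ
  have hzφ : ContDiff ℝ 1 fun x => z x * φ x := (hz.mul hφ).of_le (mod_cast le_top)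
  have hleibniz (x : Vec n) : fderiv ℝ (fun x => z x * φ x) x (basisVec i) =
      z x * fderiv ℝ φ x (basisVec i) + fderiv ℝ z x (basisVec i) * φ x := by
    rw [fderiv_fun_mul (hz.differentiable (by simp) x) (hφ.differentiable (by simp) x)]
    simp [mul_comm]
  have hint₁ : Integrable (fun x => z x * fderiv ℝ φ x (basisVec i)) (volume.restrict Ω) :=
    (hz.continuous.mul (continuous_fderiv_basisVec hφ i)).integrable_of_hasCompactSupport
      (hφc.fderiv_apply ℝ (basisVec i)).mul_left
  have hint₂ : Integrable (fun x => fderiv ℝ z x (basisVec i) * φ x) (volume.restrict Ω) :=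
    ((continuous_fderiv_basisVec hz i).mul hφ.continuous).integrable_of_hasCompactSupport
      hφc.mul_left
  rw [eq_neg_iff_add_eq_zero, ← integral_add hint₁ hint₂]
  simp only [← hleibniz]
  exact setIntegral_fderiv_eq_zero_of_tsupport_subset hzφ hφc.mul_left
    (tsupport_mul_subset_right.trans hφΩ) (basisVec i)

theorem IsWeakPartial.ae_eq (hΩ : IsOpen Ω) {f g g' : Vec n → ℝ} {i : Fin n}
    (h : IsWeakPartial Ω f i g) (h' : IsWeakPartial Ω f i g')
    (hg : MemLp g 2 (volume.restrict Ω)) (hg' : MemLp g' 2 (volume.restrict Ω)) :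
    g =ᵐ[volume.restrict Ω] g' := by
  have hloc : LocallyIntegrable (fun x => g x - g' x) (volume.restrict Ω) :=
    (hg.sub hg').locallyIntegrable one_le_two
  have hzero := hΩ.ae_eq_zero_of_integral_contDiff_smul_eq_zero
    (μ := volume.restrict Ω) (hloc.locallyIntegrableOn Ω) fun φ hφ hφc hφΩ => by
      have hdiff (x : Vec n) : φ x • (g x - g' x) = g x * φ x - g' x * φ x := by
        rw [smul_eq_mul]; ring
      have hφL : MemLp φ 2 (volume.restrict Ω) := hφ.continuous.memLp_of_hasCompactSupport hφc
      simp only [hdiff]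
      rw [integral_sub (integrable_mul_of_memLp_two hg hφL) (integrable_mul_of_memLp_two hg' hφL),
        sub_eq_zero]
      exact neg_injective ((h φ hφ hφc hφΩ).symm.trans (h' φ hφ hφc hφΩ))
  filter_upwards [hzero, ae_restrict_mem hΩ.measurableSet] with x hx hxΩ
  exact sub_eq_zero.1 (hx hxΩ)

theorem IsWeakPartial.linearComb {f f' g g' : Vec n → ℝ} {i : Fin n} (h : IsWeakPartial Ω f i g)
    (h' : IsWeakPartial Ω f' i g') (c d : ℝ) (hf : MemLp f 2 (volume.restrict Ω))
    (hf' : MemLp f' 2 (volume.restrict Ω)) (hg : MemLp g 2 (volume.restrict Ω))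
    (hg' : MemLp g' 2 (volume.restrict Ω)) :
    IsWeakPartial Ω (fun x => c * f x + d * f' x) i fun x => c * g x + d * g' x := by
  intro φ hφ hφc hφΩ
  have hφL : MemLp φ 2 (volume.restrict Ω) := hφ.continuous.memLp_of_hasCompactSupport hφc
  have hφL' : MemLp (fun x => fderiv ℝ φ x (basisVec i)) 2 (volume.restrict Ω) :=
    (continuous_fderiv_basisVec hφ i).memLp_of_hasCompactSupport
      (hφc.fderiv_apply ℝ (basisVec i))
  simp only [add_mul, mul_assoc]
  rw [integral_add ((integrable_mul_of_memLp_two hf hφL').const_mul c)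
      ((integrable_mul_of_memLp_two hf' hφL').const_mul d),
    integral_add ((integrable_mul_of_memLp_two hg hφL).const_mul c)
      ((integrable_mul_of_memLp_two hg' hφL).const_mul d)]
  simp only [integral_const_mul]
  rw [h φ hφ hφc hφΩ, h' φ hφ hφc hφΩ]
  ring

namespace MemH1

variable {f g : Vec n → ℝ}

theorem weakPartial_spec (hf : MemH1 Ω f) (i : Fin n) :
    MemLp (weakPartial Ω f i) 2 (volume.restrict Ω) ∧
      IsWeakPartial Ω f i (weakPartial Ω f i) := by
  rw [weakPartial, dif_pos (hf.2 i)]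
  exact (hf.2 i).choose_spec

theorem memLp_weakPartial (hf : MemH1 Ω f) (i : Fin n) :
    MemLp (weakPartial Ω f i) 2 (volume.restrict Ω) := (hf.weakPartial_spec i).1

theorem isWeakPartial_linearComb (hf : MemH1 Ω f) (hg : MemH1 Ω g) (c d : ℝ) (i : Fin n) :
    IsWeakPartial Ω (fun x => c * f x + d * g x) i
      fun x => c * weakPartial Ω f i x + d * weakPartial Ω g i x :=
  (hf.weakPartial_spec i).2.linearComb (hg.weakPartial_spec i).2 c d hf.1 hg.1
    (hf.memLp_weakPartial i) (hg.memLp_weakPartial i)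

theorem linearComb (hf : MemH1 Ω f) (hg : MemH1 Ω g) (c d : ℝ) :
    MemH1 Ω fun x => c * f x + d * g x :=
  ⟨(hf.1.const_mul c).add (hg.1.const_mul d), fun i =>
    ⟨_, ((hf.memLp_weakPartial i).const_mul c).add ((hg.memLp_weakPartial i).const_mul d),
      hf.isWeakPartial_linearComb hg c d i⟩⟩

theorem weakPartial_ae_eq (hf : MemH1 Ω f) (hΩ : IsOpen Ω) {i : Fin n}
    (hg : MemLp g 2 (volume.restrict Ω)) (h : IsWeakPartial Ω f i g) :
    weakPartial Ω f i =ᵐ[volume.restrict Ω] g :=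
  (hf.weakPartial_spec i).2.ae_eq hΩ h (hf.memLp_weakPartial i) hg

theorem weakPartial_linearComb (hf : MemH1 Ω f) (hg : MemH1 Ω g) (hΩ : IsOpen Ω) (c d : ℝ)
    (i : Fin n) : weakPartial Ω (fun x => c * f x + d * g x) i =ᵐ[volume.restrict Ω]
      fun x => c * weakPartial Ω f i x + d * weakPartial Ω g i x :=
  (hf.linearComb hg c d).weakPartial_ae_eq hΩ
    (((hf.memLp_weakPartial i).const_mul c).add ((hg.memLp_weakPartial i).const_mul d))
    (hf.isWeakPartial_linearComb hg c d i)

end MemH1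

theorem memLp_restrict_of_continuous (hΩb : Bornology.IsBounded Ω) {f : Vec n → ℝ}
    (hf : Continuous f) (p : ℝ≥0∞) : MemLp f p (volume.restrict Ω) :=
  memLp_of_continuous_of_ae_mem_isCompact hΩb.isCompact_closure
    (ae_restrict_of_ae_restrict_of_subset subset_closure
      (ae_restrict_mem isClosed_closure.measurableSet)) hf p

theorem memH1_of_contDiff (hΩb : Bornology.IsBounded Ω) {z : Vec n → ℝ} (hz : ContDiff ℝ ∞ z) :
    MemH1 Ω z :=
  ⟨memLp_restrict_of_continuous hΩb hz.continuous 2, fun i =>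
    ⟨_, memLp_restrict_of_continuous hΩb (continuous_fderiv_basisVec hz i) 2,
      isWeakPartial_fderiv hz i⟩⟩

theorem weakPartial_ae_eq_fderiv (hΩ : IsOpen Ω) (hΩb : Bornology.IsBounded Ω) {z : Vec n → ℝ}
    (hz : ContDiff ℝ ∞ z) (i : Fin n) :
    weakPartial Ω z i =ᵐ[volume.restrict Ω] fun x => fderiv ℝ z x (basisVec i) :=
  (memH1_of_contDiff hΩb hz).weakPartial_ae_eq hΩ
    (memLp_restrict_of_continuous hΩb (continuous_fderiv_basisVec hz i) 2)
    (isWeakPartial_fderiv hz i)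

theorem apply_sub_eq_linearComb (u v : Vec n → Vec n) (i : Fin n) :
    (fun x => (u - v) x i) = fun x => 1 * u x i + (-1) * v x i := by
  ext x
  simp [sub_eq_add_neg]

namespace MemH1Vec

variable {u v : Vec n → Vec n}

theorem add (hu : MemH1Vec Ω u) (hv : MemH1Vec Ω v) : MemH1Vec Ω (u + v) := fun i => by
  simpa using (hu i).linearComb (hv i) 1 1

theorem sub (hu : MemH1Vec Ω u) (hv : MemH1Vec Ω v) : MemH1Vec Ω (u - v) := fun i => by
  rw [apply_sub_eq_linearComb]
  exact (hu i).linearComb (hv i) 1 (-1)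

theorem weakPartial_sub (hu : MemH1Vec Ω u) (hv : MemH1Vec Ω v) (hΩ : IsOpen Ω) (i j : Fin n) :
    weakPartial Ω (fun x => (u - v) x i) j =ᵐ[volume.restrict Ω]
      fun x => weakPartial Ω (fun x => u x i) j x - weakPartial Ω (fun x => v x i) j x := by
  rw [apply_sub_eq_linearComb]
  filter_upwards [(hu i).weakPartial_linearComb (hv i) hΩ 1 (-1) j] with x hx
  rw [hx, one_mul, neg_one_mul, sub_eq_add_neg]

theorem aestronglyMeasurable (hu : MemH1Vec Ω u) : AEStronglyMeasurable u (volume.restrict Ω) := by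
  have h : AEMeasurable (fun x i => u x i) (volume.restrict Ω) :=
    aemeasurable_pi_iff.2 fun i => (hu i).1.1.aemeasurable
  exact ((PiLp.continuous_toLp 2 fun _ : Fin n => ℝ).measurable.comp_aemeasurable
    h).aestronglyMeasurable

end MemH1Vec

theorem DivFree.sub (hΩ : IsOpen Ω) {u v : Vec n → Vec n} (hdu : DivFree Ω u) (hdv : DivFree Ω v)
    (hu : MemH1Vec Ω u) (hv : MemH1Vec Ω v) : DivFree Ω (u - v) := by
  filter_upwards [ae_all_iff.2 fun i => hu.weakPartial_sub hv hΩ i i, hdu, hdv] with x hx hux hvx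
  rw [Finset.sum_congr rfl fun i _ => hx i, Finset.sum_sub_distrib, hux, hvx, sub_zero]

/-! ### Traces and Green's formula -/

theorem tendsto_eLpNorm_mul_normal (hΩ : IsOpen Ω) {A : LipschitzBoundary Ω} {g : Vec n → ℝ}
    {G : ℕ → Vec n → ℝ} {p : ℝ≥0∞}
    (h : Tendsto (fun k => eLpNorm (fun x => G k x - g x) p A.surfaceMeasure) atTop (𝓝 0))
    (i : Fin n) :
    Tendsto (fun k => eLpNorm (fun x => G k x * A.normal x i - g x * A.normal x i) p
      A.surfaceMeasure) atTop (𝓝 0) := by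
  refine tendsto_of_tendsto_of_tendsto_of_le_of_le tendsto_const_nhds h (fun _ => zero_le)
    fun k => eLpNorm_mono_ae ?_
  filter_upwards [A.ae_norm_normal_apply_le hΩ i] with x hx
  rw [← sub_mul, norm_mul]
  exact mul_le_of_le_one_right (norm_nonneg _) hx

theorem green_of_contDiff (hΩ : IsOpen Ω) (hΩb : Bornology.IsBounded Ω) (A : LipschitzBoundary Ω)
    {w z : Vec n → ℝ} (hw : ContDiff ℝ ∞ w) (hz : ContDiff ℝ ∞ z) (i : Fin n) :
    (∫ x in Ω, fderiv ℝ w x (basisVec i) * z x) + ∫ x in Ω, w x * fderiv ℝ z x (basisVec i) =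
      ∫ x, w x * (z x * A.normal x i) ∂A.surfaceMeasure := by
  have hwz : ContDiff ℝ 1 fun x => w x * z x := (hw.mul hz).of_le (mod_cast le_top)
  have hleibniz (x : Vec n) : fderiv ℝ (fun x => w x * z x) x (basisVec i) =
      fderiv ℝ w x (basisVec i) * z x + w x * fderiv ℝ z x (basisVec i) := by
    rw [fderiv_fun_mul (hw.differentiable (by simp) x) (hz.differentiable (by simp) x)]
    simp [mul_comm, add_comm]
  have hmem {f : Vec n → ℝ} (hf : Continuous f) : MemLp f 2 (volume.restrict Ω) :=
    memLp_restrict_of_continuous hΩb hf 2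
  rw [← integral_add
    (integrable_mul_of_memLp_two (hmem (continuous_fderiv_basisVec hw i)) (hmem hz.continuous))
    (integrable_mul_of_memLp_two (hmem hw.continuous) (hmem (continuous_fderiv_basisVec hz i)))]
  simp only [← hleibniz, ← mul_assoc]
  exact A.setIntegral_fderiv hΩ hΩb hwz i

variable {A : LipschitzBoundary Ω}

theorem isTrace_of_contDiff (hΩ : IsOpen Ω) (hΩb : Bornology.IsBounded Ω) {z : Vec n → ℝ}
    (hz : ContDiff ℝ ∞ z) : IsTrace A z z := by
  refine ⟨A.memLp_of_continuous hΩ hΩb hz.continuous 2, fun _ => z, fun _ => hz, by simp,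
    fun i => ?_, by simp⟩
  have hzero : eLpNorm (fun x => fderiv ℝ z x (basisVec i) - weakPartial Ω z i x) 2
      (volume.restrict Ω) = 0 := by
    refine (eLpNorm_congr_ae ?_).trans eLpNorm_zero
    filter_upwards [weakPartial_ae_eq_fderiv hΩ hΩb hz i] with x hx
    rw [hx, sub_self, Pi.zero_apply]
  simp only [hzero, tendsto_const_nhds]

namespace IsTrace

variable {f g q r : Vec n → ℝ}

theorem green (hq : IsTrace A f q) (hr : IsTrace A g r) (hΩ : IsOpen Ω)
    (hΩb : Bornology.IsBounded Ω) (hf : MemH1 Ω f) (hg : MemH1 Ω g) (i : Fin n) :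
    (∫ x in Ω, weakPartial Ω f i x * g x) + ∫ x in Ω, f x * weakPartial Ω g i x =
      ∫ x, q x * (r x * A.normal x i) ∂A.surfaceMeasure := by
  obtain ⟨hqL, w, hw, hwf, hwf', hwq⟩ := hq
  obtain ⟨hrL, z, hz, hzg, hzg', hzr⟩ := hr
  have hmem {f : Vec n → ℝ} (hf : Continuous f) : MemLp f 2 (volume.restrict Ω) :=
    memLp_restrict_of_continuous hΩb hf 2
  have hmemS {f : Vec n → ℝ} (hf : Continuous f) : MemLp f 2 A.surfaceMeasure :=
    A.memLp_of_continuous hΩ hΩb hf 2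
  have hleft := tendsto_integral_mul_of_tendsto_eLpNorm (hf.memLp_weakPartial i) hg.1
    (fun k => hmem (continuous_fderiv_basisVec (hw k) i)) (fun k => hmem (hz k).continuous)
    (hwf' i) hzg
  have hright := tendsto_integral_mul_of_tendsto_eLpNorm hf.1 (hg.memLp_weakPartial i)
    (fun k => hmem (hw k).continuous) (fun k => hmem (continuous_fderiv_basisVec (hz k) i))
    hwf (hzg' i)
  have hsurface := tendsto_integral_mul_of_tendsto_eLpNorm hqL
    (LipschitzBoundary.memLp_mul_normal hΩ hrL i) (fun k => hmemS (hw k).continuous)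
    (fun k => LipschitzBoundary.memLp_mul_normal hΩ (hmemS (hz k).continuous) i) hwq
    (tendsto_eLpNorm_mul_normal hΩ hzr i)
  exact tendsto_nhds_unique (hleft.add hright)
    (hsurface.congr fun k => (green_of_contDiff hΩ hΩb A (hw k) (hz k) i).symm)

theorem ae_eq (hq : IsTrace A f q) (hr : IsTrace A f r) (hΩ : IsOpen Ω)
    (hΩb : Bornology.IsBounded Ω) (hf : MemH1 Ω f) : q =ᵐ[A.surfaceMeasure] r := by
  have hnormal (i : Fin n) : ∀ᵐ x ∂A.surfaceMeasure, (q x - r x) * A.normal x i = 0 := by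
    have hL : MemLp (fun x => (q x - r x) * A.normal x i) 2 A.surfaceMeasure :=
      LipschitzBoundary.memLp_mul_normal hΩ (hq.1.sub hr.1) i
    refine ae_eq_zero_of_integral_contDiff_smul_eq_zero (hL.locallyIntegrable one_le_two)
      fun φ hφ _ => ?_
    have hφL : MemLp (fun x => φ x * A.normal x i) 2 A.surfaceMeasure :=
      LipschitzBoundary.memLp_mul_normal hΩ (A.memLp_of_continuous hΩ hΩb hφ.continuous 2) i
    have hφt : IsTrace A φ φ := isTrace_of_contDiff hΩ hΩb hφ
    have hφH : MemH1 Ω φ := memH1_of_contDiff hΩb hφ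
    calc ∫ x, φ x • ((q x - r x) * A.normal x i) ∂A.surfaceMeasure
        = ∫ x, (q x * (φ x * A.normal x i) - r x * (φ x * A.normal x i)) ∂A.surfaceMeasure := by
          congr 1 with x
          rw [smul_eq_mul]
          ring
      _ = 0 := by
          rw [integral_sub (integrable_mul_of_memLp_two hq.1 hφL)
            (integrable_mul_of_memLp_two hr.1 hφL), ← hq.green hφt hΩ hΩb hf hφH,
            ← hr.green hφt hΩ hΩb hf hφH, sub_self]
  filter_upwards [ae_all_iff.2 hnormal, A.ae_mem_frontier hΩ] with x hx hxS
  obtain ⟨k, hk⟩ := A.exists_mem_piece hxS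
  have hν : A.normal x ≠ 0 := by
    rw [← norm_ne_zero_iff, A.normal_of_mem_piece hk, (A.chart k).norm_graphNormal x]
    exact one_ne_zero
  obtain ⟨i, hi⟩ : ∃ i, A.normal x i ≠ 0 := by
    by_contra! h
    exact hν (by ext i; simpa using h i)
  exact sub_eq_zero.1 ((mul_eq_zero.1 (hx i)).resolve_right hi)

theorem linearComb (hq : IsTrace A f q) (hr : IsTrace A g r) (hΩ : IsOpen Ω)
    (hΩb : Bornology.IsBounded Ω) (hf : MemH1 Ω f) (hg : MemH1 Ω g) (c d : ℝ) :
    IsTrace A (fun x => c * f x + d * g x) fun x => c * q x + d * r x := by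
  obtain ⟨hqL, w, hw, hwf, hwf', hwq⟩ := hq
  obtain ⟨hrL, z, hz, hzg, hzg', hzr⟩ := hr
  have hmem {f : Vec n → ℝ} (hf : Continuous f) : MemLp f 2 (volume.restrict Ω) :=
    memLp_restrict_of_continuous hΩb hf 2
  have hmemS {f : Vec n → ℝ} (hf : Continuous f) : MemLp f 2 A.surfaceMeasure :=
    A.memLp_of_continuous hΩ hΩb hf 2
  refine ⟨(hqL.const_mul c).add (hrL.const_mul d), fun k x => c * w k x + d * z k x,
    fun k => (contDiff_const.mul (hw k)).add (contDiff_const.mul (hz k)), ?_, fun i => ?_, ?_⟩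
  · exact tendsto_eLpNorm_linearComb c d hf.1 hg.1 (fun k => hmem (hw k).continuous)
      (fun k => hmem (hz k).continuous) hwf hzg
  · refine (tendsto_eLpNorm_linearComb c d (hf.memLp_weakPartial i) (hg.memLp_weakPartial i)
      (fun k => hmem (continuous_fderiv_basisVec (hw k) i))
      (fun k => hmem (continuous_fderiv_basisVec (hz k) i)) (hwf' i) (hzg' i)).congr
      fun k => eLpNorm_congr_ae ?_
    have hdw := (hw k).differentiable (by simp)
    have hdz := (hz k).differentiable (by simp)
    filter_upwards [hf.weakPartial_linearComb hg hΩ c d i] with x hx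
    rw [hx, fderiv_fun_add ((hdw x).const_mul c) ((hdz x).const_mul d),
      fderiv_const_mul (hdw x), fderiv_const_mul (hdz x)]
    rfl
  · exact tendsto_eLpNorm_linearComb c d hqL hrL (fun k => hmemS (hw k).continuous)
      (fun k => hmemS (hz k).continuous) hwq hzr

theorem isTrace_trace (h : IsTrace A f q) : IsTrace A f (trace A f) := by
  rw [trace, dif_pos ⟨q, h⟩]
  exact (⟨q, h⟩ : ∃ q, IsTrace A f q).choose_spec

end IsTrace

theorem EqOnBoundary.sub (hΩ : IsOpen Ω) (hΩb : Bornology.IsBounded Ω) {S : Set (Vec n)}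
    {u v ub vb : Vec n → Vec n} (hub : EqOnBoundary A S u ub) (hvb : EqOnBoundary A S v vb)
    (hu : MemH1Vec Ω u) (hv : MemH1Vec Ω v) : EqOnBoundary A S (u - v) (ub - vb) := fun i => by
  obtain ⟨q, hq, hq_eq⟩ := hub i
  obtain ⟨r, hr, hr_eq⟩ := hvb i
  rw [apply_sub_eq_linearComb]
  refine ⟨_, hq.linearComb hr hΩ hΩb (hu i) (hv i) 1 (-1), ?_⟩
  filter_upwards [hq_eq, hr_eq] with x hqx hrx
  rw [hqx, hrx, Pi.sub_apply, PiLp.sub_apply]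
  ring

theorem sub_mem_V (hΩ : IsOpen Ω) (hΩb : Bornology.IsBounded Ω) {S : Set (Vec n)}
    {u v ub : Vec n → Vec n} (hu : MemH1Vec Ω u) (hv : MemH1Vec Ω v)
    (hub : EqOnBoundary A S u ub) (hvb : EqOnBoundary A S v ub) (hdu : DivFree Ω u)
    (hdv : DivFree Ω v) : u - v ∈ V A S :=
  ⟨⟨hu.sub hv, sub_self ub ▸ hub.sub hΩ hΩb hvb hu hv⟩, hdu.sub hΩ hdv hu hv⟩

/-! ### The principle of virtual work -/

section VirtualWork

variable {A : LipschitzBoundary Ω} {S₁ S₂ : Set (Vec n)}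

namespace IsBoundarySplitting

theorem measurableSet_fst (hS : IsBoundarySplitting A S₁ S₂) : MeasurableSet S₁ := by
  obtain ⟨O, hO, rfl⟩ := hS.open_fst
  exact hO.measurableSet.inter isClosed_frontier.measurableSet

theorem measurableSet_snd (hS : IsBoundarySplitting A S₁ S₂) : MeasurableSet S₂ := by
  obtain ⟨O, hO, rfl⟩ := hS.open_snd
  exact hO.measurableSet.inter isClosed_frontier.measurableSet

theorem ae_mem_union (hS : IsBoundarySplitting A S₁ S₂) (hΩ : IsOpen Ω) :
    ∀ᵐ x ∂A.surfaceMeasure, x ∈ S₁ ∪ S₂ := by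
  filter_upwards [A.ae_mem_frontier hΩ, measure_eq_zero_iff_ae_notMem.1 hS.interface_null]
    with x hx hx'
  by_contra h
  exact hx' ⟨hx, h⟩

end IsBoundarySplitting

variable {w : Vec n → Vec n}

theorem isTrace_trace_of_mem_X (hw : w ∈ X A S₁) (i : Fin n) :
    IsTrace A (fun x => w x i) (trace A fun x => w x i) := by
  obtain ⟨g, hg, -⟩ := hw.2 i
  exact hg.isTrace_trace

theorem trace_ae_eq_zero_of_mem_X (hΩ : IsOpen Ω) (hΩb : Bornology.IsBounded Ω)
    (hS₁ : MeasurableSet S₁) (hw : w ∈ X A S₁) (i : Fin n) :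
    ∀ᵐ x ∂A.surfaceMeasure, x ∈ S₁ → trace A (fun x => w x i) x = 0 := by
  obtain ⟨g, hg, hg0⟩ := hw.2 i
  rw [ae_restrict_iff' hS₁] at hg0
  filter_upwards [hg0, hg.isTrace_trace.ae_eq hg hΩ hΩb (hw.1 i)] with x hx0 hxg hx
  rw [hxg, hx0 hx, Pi.zero_apply, PiLp.zero_apply]

variable {τ t : Fin n → Fin n → Vec n → ℝ}

theorem volumeWork_eq_sum {K : Vec n → Vec n} (hτ : ∀ i j, MemH1 Ω (τ i j)) (hw : MemH1Vec Ω w)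
    (hK : ∀ i, ∀ᵐ x ∂volume.restrict Ω, -∑ j, weakPartial Ω (τ i j) j x = K x i) :
    volumeWork Ω K w = ∑ i, ∑ j, -∫ x in Ω, weakPartial Ω (τ i j) j x * w x i := by
  have hint (i j : Fin n) :
      Integrable (fun x => weakPartial Ω (τ i j) j x * w x i) (volume.restrict Ω) :=
    integrable_mul_of_memLp_two ((hτ i j).memLp_weakPartial j) (hw i).1
  have hrow (i : Fin n) : Integrable
      (fun x => -∑ j, weakPartial Ω (τ i j) j x * w x i) (volume.restrict Ω) :=
    (integrable_finsetSum _ fun j _ => hint i j).neg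
  calc volumeWork Ω K w
      = ∫ x in Ω, ∑ i, -∑ j, weakPartial Ω (τ i j) j x * w x i := by
        refine integral_congr_ae ?_
        filter_upwards [ae_all_iff.2 hK] with x hx
        simp only [← hx, neg_mul, Finset.sum_mul]
    _ = ∑ i, ∑ j, -∫ x in Ω, weakPartial Ω (τ i j) j x * w x i := by
        rw [integral_finsetSum _ fun i _ => hrow i]
        refine Finset.sum_congr rfl fun i _ => ?_
        rw [integral_neg, integral_finsetSum _ fun j _ => hint i j, Finset.sum_neg_distrib]

theorem surfaceWork_eq_sum (hΩ : IsOpen Ω) (hΩb : Bornology.IsBounded Ω)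
    (hS : IsBoundarySplitting A S₁ S₂) {F : Vec n → Vec n}
    (ht : ∀ i j, MemLp (t i j) 2 A.surfaceMeasure) (hw : w ∈ X A S₁)
    (hF : ∀ i, ∀ᵐ x ∂A.surfaceMeasure.restrict S₂, ∑ j, t i j x * A.normal x j = F x i) :
    surfaceWork A S₂ F w =
      ∑ i, ∑ j, ∫ x, t i j x * (trace A (fun z => w z i) x * A.normal x j) ∂A.surfaceMeasure := by
  have hint (i j : Fin n) : Integrable
      (fun x => t i j x * (trace A (fun z => w z i) x * A.normal x j)) A.surfaceMeasure :=
    integrable_mul_of_memLp_two (ht i j)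
      (LipschitzBoundary.memLp_mul_normal hΩ (isTrace_trace_of_mem_X hw i).1 j)
  calc surfaceWork A S₂ F w
      = ∫ x, S₂.indicator (fun x => ∑ i, F x i * trace A (fun z => w z i) x) x
          ∂A.surfaceMeasure := (integral_indicator hS.measurableSet_snd).symm
    _ = ∫ x, ∑ i, ∑ j, t i j x * (trace A (fun z => w z i) x * A.normal x j)
          ∂A.surfaceMeasure := by
        refine integral_congr_ae ?_
        filter_upwards [hS.ae_mem_union hΩ,
          (ae_restrict_iff' hS.measurableSet_snd).1 (ae_all_iff.2 hF),
          ae_all_iff.2 (trace_ae_eq_zero_of_mem_X hΩ hΩb hS.measurableSet_fst hw)]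
          with x hxS hxF hx0
        by_cases hx : x ∈ S₂
        · simp only [indicator_of_mem hx, ← hxF hx, Finset.sum_mul, mul_assoc, mul_comm]
        · have hx₁ : x ∈ S₁ := hxS.resolve_right hx
          simp [indicator_of_notMem hx, hx0 _ hx₁]
    _ = ∑ i, ∑ j, ∫ x, t i j x * (trace A (fun z => w z i) x * A.normal x j)
          ∂A.surfaceMeasure := by
        rw [integral_finsetSum _ fun i _ => integrable_finsetSum _ fun j _ => hint i j]
        exact Finset.sum_congr rfl fun i _ => integral_finsetSum _ fun j _ => hint i j

theorem volumeWork_add_surfaceWork (hΩ : IsOpen Ω) (hΩb : Bornology.IsBounded Ω)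
    (hS : IsBoundarySplitting A S₁ S₂) {K F : Vec n → Vec n} (hτ : ∀ i j, MemH1 Ω (τ i j))
    (ht : ∀ i j, IsTrace A (τ i j) (t i j))
    (hK : ∀ i, ∀ᵐ x ∂volume.restrict Ω, -∑ j, weakPartial Ω (τ i j) j x = K x i)
    (hF : ∀ i, ∀ᵐ x ∂A.surfaceMeasure.restrict S₂, ∑ j, t i j x * A.normal x j = F x i)
    (hw : w ∈ X A S₁) :
    volumeWork Ω K w + surfaceWork A S₂ F w =
      ∫ x in Ω, ∑ i, ∑ j, τ i j x * weakPartial Ω (fun z => w z i) j x := by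
  have hint (i j : Fin n) : Integrable
      (fun x => τ i j x * weakPartial Ω (fun z => w z i) j x) (volume.restrict Ω) :=
    integrable_mul_of_memLp_two (hτ i j).1 ((hw.1 i).memLp_weakPartial j)
  rw [volumeWork_eq_sum hτ hw.1 hK, surfaceWork_eq_sum hΩ hΩb hS (fun i j => (ht i j).1) hw hF,
    integral_finsetSum _ fun i _ => integrable_finsetSum _ fun j _ => hint i j,
    ← Finset.sum_add_distrib]
  refine Finset.sum_congr rfl fun i _ => ?_
  rw [integral_finsetSum _ fun j _ => hint i j, ← Finset.sum_add_distrib]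
  refine Finset.sum_congr rfl fun j _ => ?_
  rw [← (ht i j).green (isTrace_trace_of_mem_X hw i) hΩ hΩb (hτ i j) (hw.1 i) j,
    neg_add_cancel_left]

end VirtualWork

/-- The scalar product `ε_ij(u) ε_ij(w)` of two rate of strain tensors; `inv2` is its diagonal. -/
noncomputable def strainInner (Ω : Set (Vec n)) (u w : Vec n → Vec n) (x : Vec n) : ℝ :=
  ∑ i, ∑ j, strain Ω u i j x * strain Ω w i j x

theorem strain_comm (u : Vec n → Vec n) (i j : Fin n) (x : Vec n) :
    strain Ω u i j x = strain Ω u j i x := by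
  rw [strain, strain, add_comm]

theorem sum_strain_mul_weakPartial (u w : Vec n → Vec n) (x : Vec n) :
    ∑ i, ∑ j, strain Ω u i j x * weakPartial Ω (fun z => w z i) j x = strainInner Ω u w x := by
  have hswap : ∑ i, ∑ j, strain Ω u i j x * weakPartial Ω (fun z => w z j) i x =
      ∑ i, ∑ j, strain Ω u i j x * weakPartial Ω (fun z => w z i) j x := by
    rw [Finset.sum_comm]
    simp only [strain_comm u]
  have hsplit : strainInner Ω u w x =
      (∑ i, ∑ j, strain Ω u i j x * weakPartial Ω (fun z => w z i) j x +
        ∑ i, ∑ j, strain Ω u i j x * weakPartial Ω (fun z => w z j) i x) / 2 := by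
    simp only [strainInner, strain, ← Finset.sum_add_distrib, Finset.sum_div, ← mul_add,
      mul_div_assoc]
  rw [hsplit, hswap, add_self_div_two]

theorem sum_stress_mul_weakPartial {w : Vec n → Vec n} {x : Vec n}
    (hdiv : ∑ i, weakPartial Ω (fun z => w z i) i x = 0) (u : Vec n → Vec n) (p φ : ℝ) :
    ∑ i, ∑ j, (-(if i = j then 1 else 0) * p + 2 * (φ * strain Ω u i j x)) *
      weakPartial Ω (fun z => w z i) j x = 2 * (φ * strainInner Ω u w x) := by
  have hsplit (i j : Fin n) : (-(if i = j then 1 else 0) * p + 2 * (φ * strain Ω u i j x)) *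
      weakPartial Ω (fun z => w z i) j x =
        (if i = j then -p * weakPartial Ω (fun z => w z i) j x else 0) +
          2 * φ * (strain Ω u i j x * weakPartial Ω (fun z => w z i) j x) := by
    split_ifs <;> ring
  simp only [hsplit, Finset.sum_add_distrib, Finset.sum_ite_eq, Finset.mem_univ, if_true,
    ← Finset.mul_sum]
  rw [hdiv, sum_strain_mul_weakPartial]
  ring

namespace IsRegularSolution

variable {A : LipschitzBoundary Ω} {S₁ S₂ : Set (Vec n)} {α : ℝ} {uc : Vec n}
  {E K F ub u : Vec n → Vec n} {b : ℝ → ℝ → ℝ} {ψ : ℝ → ℝ → ℝ → ℝ} {p : Vec n → ℝ}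

theorem volumeWork_add_surfaceWork (h : IsRegularSolution A S₁ S₂ α uc E b ψ K F ub u p)
    (hΩ : IsOpen Ω) (hΩb : Bornology.IsBounded Ω) (hS : IsBoundarySplitting A S₁ S₂)
    {w : Vec n → Vec n} (hw : w ∈ V A S₁) :
    volumeWork Ω K w + surfaceWork A S₂ F w =
      2 * ∫ x in Ω, viscosity Ω α uc E b ψ u x * strainInner Ω u w x := by
  obtain ⟨q, T, hq, hT, hF⟩ := h.stress_boundary
  set σ : Fin n → Fin n → Vec n → ℝ :=
    fun i j x => viscosity Ω α uc E b ψ u x * strain Ω u i j x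
  set δ : Fin n → Fin n → ℝ := fun i j => if i = j then 1 else 0 with hδ
  have hmomentum (i : Fin n) : ∀ᵐ x ∂volume.restrict Ω,
      -∑ j, weakPartial Ω (fun x => -δ i j * p x + 2 * σ i j x) j x = K x i := by
    have hlinear := ae_all_iff.2 fun j =>
      h.pressure_mem.weakPartial_linearComb (h.stress_mem i j) hΩ (-δ i j) 2 j
    filter_upwards [hlinear, h.momentum i] with x hx hxK
    rw [← hxK, Finset.sum_congr rfl fun j _ => hx j]
    simp only [hδ, Finset.sum_add_distrib, ← Finset.mul_sum, neg_mul, Finset.sum_neg_distrib,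
      ite_mul, one_mul, zero_mul, Finset.sum_ite_eq, Finset.mem_univ, if_true]
    ring
  have htraction (i : Fin n) : ∀ᵐ x ∂A.surfaceMeasure.restrict S₂,
      ∑ j, (-δ i j * q x + 2 * T i j x) * A.normal x j = F x i := by
    filter_upwards [hF i] with x hx
    rw [← hx]
    exact Finset.sum_congr rfl fun j _ => by ring
  rw [ERFluid.volumeWork_add_surfaceWork hΩ hΩb hS
    (fun i j => h.pressure_mem.linearComb (h.stress_mem i j) (-δ i j) 2)
    (fun i j => hq.linearComb (hT i j) hΩ hΩb h.pressure_mem (h.stress_mem i j) (-δ i j) 2)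
    hmomentum htraction hw.1, ← integral_const_mul]
  refine integral_congr_ae ?_
  filter_upwards [hw.2] with x hx
  exact sum_stress_mul_weakPartial hx u (p x) _

end IsRegularSolution

/-! ### Strain and dissipation -/

section Strain

variable {u w : Vec n → Vec n}

theorem strainInner_self (u : Vec n → Vec n) (x : Vec n) :
    strainInner Ω u u x = inv2 Ω u x := by
  simp only [strainInner, inv2, sq]

theorem inv2_nonneg (u : Vec n → Vec n) (x : Vec n) : 0 ≤ inv2 Ω u x :=
  Finset.sum_nonneg fun _ _ => Finset.sum_nonneg fun _ _ => sq_nonneg _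

theorem abs_strainInner_le (u w : Vec n → Vec n) (x : Vec n) :
    |strainInner Ω u w x| ≤ √(inv2 Ω u x) * √(inv2 Ω w x) := by
  rw [← Real.sqrt_mul (inv2_nonneg u x)]
  refine Real.abs_le_sqrt ?_
  simpa only [Fintype.sum_prod_type, strainInner, inv2] using Finset.sum_mul_sq_le_sq_mul_sq
    Finset.univ (fun z : Fin n × Fin n => strain Ω u z.1 z.2 x) (fun z => strain Ω w z.1 z.2 x)

theorem strainInner_sub (hΩ : IsOpen Ω) (hu : MemH1Vec Ω u) (hw : MemH1Vec Ω w) :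
    ∀ᵐ x ∂volume.restrict Ω, strainInner Ω u (w - u) x = strainInner Ω u w x - inv2 Ω u x := by
  have hpartial : ∀ᵐ x ∂volume.restrict Ω, ∀ i j, weakPartial Ω (fun z => (w - u) z i) j x =
      weakPartial Ω (fun z => w z i) j x - weakPartial Ω (fun z => u z i) j x :=
    ae_all_iff.2 fun i => ae_all_iff.2 fun j => hw.weakPartial_sub hu hΩ i j
  filter_upwards [hpartial] with x hx
  have hstrain (i j : Fin n) : strain Ω (w - u) i j x = strain Ω w i j x - strain Ω u i j x := by
    simp only [strain, hx]
    ring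
  simp only [← strainInner_self, strainInner, hstrain, mul_sub, Finset.sum_sub_distrib]

namespace MemH1Vec

theorem memLp_strain (hu : MemH1Vec Ω u) (i j : Fin n) :
    MemLp (strain Ω u i j) 2 (volume.restrict Ω) := by
  simpa only [strain, div_eq_mul_inv] using!
    (((hu i).memLp_weakPartial j).add ((hu j).memLp_weakPartial i)).mul_const 2⁻¹

theorem integrable_strainInner (hu : MemH1Vec Ω u) (hw : MemH1Vec Ω w) :
    Integrable (strainInner Ω u w) (volume.restrict Ω) :=
  integrable_finsetSum _ fun i _ => integrable_finsetSum _ fun j _ =>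
    integrable_mul_of_memLp_two (hu.memLp_strain i j) (hw.memLp_strain i j)

theorem integrable_inv2 (hu : MemH1Vec Ω u) : Integrable (inv2 Ω u) (volume.restrict Ω) :=
  (hu.integrable_strainInner hu).congr (ae_of_all _ (strainInner_self u))

theorem integrable_sqrt_inv2 (hΩb : Bornology.IsBounded Ω) (hu : MemH1Vec Ω u) :
    Integrable (fun x => √(inv2 Ω u x)) (volume.restrict Ω) := by
  have : Fact (volume Ω < ⊤) := ⟨hΩb.measure_lt_top⟩
  have hmeas := Real.continuous_sqrt.comp_aestronglyMeasurable hu.integrable_inv2.1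
  refine MemLp.integrable one_le_two ((memLp_two_iff_integrable_sq hmeas).2 ?_)
  simpa only [Function.comp_apply, Real.sq_sqrt (inv2_nonneg u _)] using hu.integrable_inv2

theorem integrable_strainInner_div_sqrt (hΩb : Bornology.IsBounded Ω) (hu : MemH1Vec Ω u)
    (hw : MemH1Vec Ω w) :
    Integrable (fun x => strainInner Ω u w x / √(inv2 Ω u x)) (volume.restrict Ω) := by
  refine (hw.integrable_sqrt_inv2 hΩb).mono ?_ (ae_of_all _ fun x => ?_)
  · exact ((hu.integrable_strainInner hw).aemeasurable.div
      (hu.integrable_sqrt_inv2 hΩb).aemeasurable).aestronglyMeasurable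
  · rw [norm_div, Real.norm_of_nonneg (Real.sqrt_nonneg _),
      Real.norm_of_nonneg (Real.sqrt_nonneg _)]
    exact div_le_of_le_mul₀ (Real.sqrt_nonneg _) (Real.sqrt_nonneg _)
      ((abs_strainInner_le u w x).trans_eq (mul_comm _ _))

end MemH1Vec

end Strain

section Angle

variable {α : ℝ} {u E : Vec n → Vec n} {m : Measure (Vec n)}

theorem angle_mem_Icc (hα : 0 ≤ α) (uc : Vec n) (u E : Vec n → Vec n) (x : Vec n) :
    angle α uc u E x ∈ Icc (0 : ℝ) 1 := by
  refine ⟨sq_nonneg _, ?_⟩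
  rw [angle, sq_le_one_iff_abs_le_one, ← Real.norm_eq_abs]
  refine (norm_inner_le_norm _ _).trans (mul_le_one₀ ?_ (norm_nonneg _) ?_)
  · have hpos : 0 ≤ α * √n + ‖u x + uc‖ := by positivity
    have hone : ‖α • WithLp.toLp 2 (fun _ : Fin n => (1 : ℝ))‖ = α * √n := by
      rw [norm_smul, Real.norm_of_nonneg hα, EuclideanSpace.norm_eq]
      simp
    rw [norm_smul, norm_inv, Real.norm_of_nonneg hpos, add_assoc]
    exact inv_mul_le_one_of_le₀ ((norm_add_le _ _).trans_eq (by rw [hone])) hpos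
  · rw [norm_smul, norm_inv, norm_norm]
    exact inv_mul_le_one

theorem aestronglyMeasurable_angle (α : ℝ) (uc : Vec n) (hu : AEStronglyMeasurable u m)
    (hE : AEStronglyMeasurable E m) : AEStronglyMeasurable (angle α uc u E) m := by
  have hu_inv : AEMeasurable (fun x => (α * √n + ‖u x + uc‖)⁻¹) m :=
    ((hu.add_const uc).norm.aemeasurable.const_add _).inv
  have hE_inv : AEMeasurable (fun x => ‖E x‖⁻¹) m := hE.norm.aemeasurable.inv
  exact ((hu_inv.aestronglyMeasurable.smul ((hu.const_add _).add_const uc)).inner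
    (hE_inv.aestronglyMeasurable.smul hE)).pow 2

end Angle

namespace PlasticityCoefficient

variable {b : ℝ → ℝ → ℝ} {m : Measure (Vec n)} {e θ : Vec n → ℝ}

theorem nonneg (hb : PlasticityCoefficient b) {y₁ y₂ : ℝ} (h₁ : 0 ≤ y₁)
    (h₂ : y₂ ∈ Icc (0 : ℝ) 1) : 0 ≤ b y₁ y₂ := by
  obtain ⟨a, -, ha⟩ := hb.2
  exact (ha y₁ h₁ y₂ h₂).1

theorem aestronglyMeasurable_comp (hb : PlasticityCoefficient b) (he : AEStronglyMeasurable e m)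
    (hθ : AEStronglyMeasurable θ m) (he₀ : ∀ x, 0 ≤ e x) (hθ₀ : ∀ x, θ x ∈ Icc (0 : ℝ) 1) :
    AEStronglyMeasurable (fun x => b (e x) (θ x)) m := by
  -- `b` is only continuous on the strip, so it is precomposed with a retraction onto it
  let c : ℝ × ℝ → ℝ × ℝ := fun y => (max 0 y.1, max 0 (min 1 y.2))
  have hc : Continuous fun y : ℝ × ℝ => b (c y).1 (c y).2 :=
    hb.1.comp_continuous (f := c) (by fun_prop) fun y =>
      ⟨mem_Ici.2 (le_max_left _ _), le_max_left _ _, max_le zero_le_one (min_le_left _ _)⟩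
  refine (hc.comp_aestronglyMeasurable (he.prodMk hθ)).congr (ae_of_all _ fun x => ?_)
  simp [c, he₀ x, (hθ₀ x).1, (hθ₀ x).2]

theorem integrable_mul (hb : PlasticityCoefficient b) (he : AEStronglyMeasurable e m)
    (hθ : AEStronglyMeasurable θ m) (he₀ : ∀ x, 0 ≤ e x) (hθ₀ : ∀ x, θ x ∈ Icc (0 : ℝ) 1)
    {f : Vec n → ℝ} (hf : Integrable f m) : Integrable (fun x => b (e x) (θ x) * f x) m := by
  obtain ⟨a, -, ha⟩ := hb.2
  refine hf.bdd_mul (c := a) (hb.aestronglyMeasurable_comp he hθ he₀ hθ₀) (ae_of_all _ fun x => ?_)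
  obtain ⟨h0, hle⟩ := ha (e x) (he₀ x) (θ x) (hθ₀ x)
  rwa [Real.norm_of_nonneg h0]

end PlasticityCoefficient

theorem plastic_dissipation_le {β s t r : ℝ} (hβ : 0 ≤ β) (hs : 0 ≤ s) (ht : 0 ≤ t)
    (hr : r ≤ s * t) : β * ((r - s ^ 2) / s) ≤ β * t - β * s := by
  rw [← mul_sub]
  refine mul_le_mul_of_nonneg_left ?_ hβ
  rcases hs.eq_or_lt with rfl | hs
  · simpa using ht
  · rw [div_le_iff₀ hs]
    linarith

section Dissipation

variable {α : ℝ} {uc : Vec n} {E u s w : Vec n → Vec n} {b : ℝ → ℝ → ℝ} {ψ : ℝ → ℝ → ℝ → ℝ}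

theorem viscosity_mul_strainInner (α : ℝ) (uc : Vec n) (E : Vec n → Vec n) (b : ℝ → ℝ → ℝ)
    (ψ : ℝ → ℝ → ℝ → ℝ) (u w : Vec n → Vec n) (x : Vec n) :
    viscosity Ω α uc E b ψ u x * strainInner Ω u w x =
      b ‖E x‖ (angle α uc u E x) * (strainInner Ω u w x / √(inv2 Ω u x)) +
        ψ (inv2 Ω u x) ‖E x‖ (angle α uc u E x) * strainInner Ω u w x := by
  rw [viscosity]
  ring

theorem integrable_plasticity_mul (hE : AEStronglyMeasurable E (volume.restrict Ω)) (hα : 0 ≤ α)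
    (hb : PlasticityCoefficient b) (hu : MemH1Vec Ω u) {f : Vec n → ℝ}
    (hf : Integrable f (volume.restrict Ω)) :
    Integrable (fun x => b ‖E x‖ (angle α uc u E x) * f x) (volume.restrict Ω) :=
  hb.integrable_mul hE.norm (aestronglyMeasurable_angle α uc hu.aestronglyMeasurable hE)
    (fun _ => norm_nonneg _) (angle_mem_Icc hα uc u E) hf

theorem integrable_viscosity_mul_strainInner
    (hσ : ∀ i j, MemH1 Ω fun x => viscosity Ω α uc E b ψ u x * strain Ω u i j x)
    (hw : MemH1Vec Ω w) :
    Integrable (fun x => viscosity Ω α uc E b ψ u x * strainInner Ω u w x)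
      (volume.restrict Ω) := by
  simp only [strainInner, Finset.mul_sum, ← mul_assoc]
  exact integrable_finsetSum _ fun i _ => integrable_finsetSum _ fun j _ =>
    integrable_mul_of_memLp_two (hσ i j).1 (hw.memLp_strain i j)

theorem integrable_material_mul_strainInner (hΩb : Bornology.IsBounded Ω)
    (hE : AEStronglyMeasurable E (volume.restrict Ω)) (hα : 0 ≤ α)
    (hb : PlasticityCoefficient b) (hu : MemH1Vec Ω u)
    (hσ : ∀ i j, MemH1 Ω fun x => viscosity Ω α uc E b ψ u x * strain Ω u i j x)
    (hw : MemH1Vec Ω w) :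
    Integrable (fun x => ψ (inv2 Ω u x) ‖E x‖ (angle α uc u E x) * strainInner Ω u w x)
      (volume.restrict Ω) := by
  refine ((integrable_viscosity_mul_strainInner hσ hw).sub (integrable_plasticity_mul (uc := uc)
    hE hα hb hu (hu.integrable_strainInner_div_sqrt hΩb hw))).congr (ae_of_all _ fun x => ?_)
  simp only [Pi.sub_apply, viscosity_mul_strainInner, add_sub_cancel_left]

theorem integral_viscosity_mul_strainInner_le (hΩ : IsOpen Ω) (hΩb : Bornology.IsBounded Ω)
    (hE : AEStronglyMeasurable E (volume.restrict Ω)) (hα : 0 ≤ α)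
    (hb : PlasticityCoefficient b) (hu : MemH1Vec Ω u)
    (hσ : ∀ i j, MemH1 Ω fun x => viscosity Ω α uc E b ψ u x * strain Ω u i j x)
    (hs : MemH1Vec Ω s) :
    ∫ x in Ω, viscosity Ω α uc E b ψ u x * strainInner Ω u (s - u) x ≤
      (∫ x in Ω, b ‖E x‖ (angle α uc u E x) * √(inv2 Ω s x)) -
        (∫ x in Ω, b ‖E x‖ (angle α uc u E x) * √(inv2 Ω u x)) +
        ∫ x in Ω, ψ (inv2 Ω u x) ‖E x‖ (angle α uc u E x) * strainInner Ω u (s - u) x := by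
  have hsu : MemH1Vec Ω (s - u) := hs.sub hu
  have hJs := integrable_plasticity_mul (uc := uc) hE hα hb hu (hs.integrable_sqrt_inv2 hΩb)
  have hJu := integrable_plasticity_mul (uc := uc) hE hα hb hu (hu.integrable_sqrt_inv2 hΩb)
  have hL := integrable_material_mul_strainInner hΩb hE hα hb hu hσ hsu
  have hJ : Integrable (fun x => b ‖E x‖ (angle α uc u E x) * √(inv2 Ω s x) -
      b ‖E x‖ (angle α uc u E x) * √(inv2 Ω u x)) (volume.restrict Ω) := hJs.sub hJu
  rw [← integral_sub hJs hJu, ← integral_add hJ hL]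
  refine integral_mono_ae (integrable_viscosity_mul_strainInner hσ hsu) (hJ.add hL) ?_
  filter_upwards [strainInner_sub hΩ hu hs] with x hx
  have hdissipation := plastic_dissipation_le
    (hb.nonneg (norm_nonneg (E x)) (angle_mem_Icc hα uc u E x)) (Real.sqrt_nonneg (inv2 Ω u x))
    (Real.sqrt_nonneg (inv2 Ω s x)) ((le_abs_self _).trans (abs_strainInner_le u s x))
  rw [Real.sq_sqrt (inv2_nonneg u x), ← hx] at hdissipation
  rw [viscosity_mul_strainInner]
  exact add_le_add_left hdissipation _

end Dissipation

theorem IsRegularSolution.volumeWork_add_surfaceWork_le {A : LipschitzBoundary Ω}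
    {S₁ S₂ : Set (Vec n)} {α : ℝ} {uc : Vec n} {E K F ub ut v h : Vec n → Vec n} {b : ℝ → ℝ → ℝ}
    {ψ : ℝ → ℝ → ℝ → ℝ} {p : Vec n → ℝ}
    (hreg : IsRegularSolution A S₁ S₂ α uc E b ψ K F ub (ut + v) p) (hΩ : IsOpen Ω)
    (hΩb : Bornology.IsBounded Ω) (hS : IsBoundarySplitting A S₁ S₂)
    (hE : AEStronglyMeasurable E (volume.restrict Ω)) (hα : 0 ≤ α)
    (hb : PlasticityCoefficient b) (hut : MemH1Vec Ω ut) (hv : v ∈ V A S₁) (hh : h ∈ V A S₁) :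
    volumeWork Ω K (h - v) + surfaceWork A S₂ F (h - v) ≤
      J Ω α uc E b ut v h - J Ω α uc E b ut v v + L Ω α uc E ψ ut v (h - v) := by
  have hhv : h - v ∈ V A S₁ := sub_mem_V hΩ hΩb hh.1.1 hv.1.1 hh.1.2 hv.1.2 hh.2 hv.2
  have hdissipation := integral_viscosity_mul_strainInner_le hΩ hΩb hE hα hb hreg.velocity_mem
    hreg.stress_mem (hut.add hh.1.1)
  rw [add_sub_add_left_eq_sub] at hdissipation
  rw [hreg.volumeWork_add_surfaceWork hΩ hΩb hS hhv]
  calc _ ≤ _ := mul_le_mul_of_nonneg_left hdissipation zero_le_two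
    _ = _ := by rw [mul_add, mul_sub]; rfl

end ERFluid

open ERFluid in
theorem theorem4p1_general {n : ℕ} {Ω : Set (Vec n)} (hΩ_open : IsOpen Ω)
    (hΩ_bdd : Bornology.IsBounded Ω) (A : LipschitzBoundary Ω) {S₁ S₂ : Set (Vec n)}
    (hS : IsBoundarySplitting A S₁ S₂)
    (E : Vec n → Vec n) (hE : AEStronglyMeasurable E (volume.restrict Ω))
    (α : ℝ) (hα : 0 ≤ α) (uc : Vec n) (b : ℝ → ℝ → ℝ) (hb : PlasticityCoefficient b)
    (ψ : ℝ → ℝ → ℝ → ℝ) (K F ub : Vec n → Vec n)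
    (ut : Vec n → Vec n) (hut : MemH1Vec Ω ut) (hut_bdry : EqOnBoundary A S₁ ut ub)
    (hut_div : DivFree Ω ut) (v : Vec n → Vec n) (p : Vec n → ℝ)
    (_hα_zero : α = 0 → ∀ᵐ x ∂(volume.restrict Ω), ut x + v x + uc ≠ 0)
    (hreg : IsRegularSolution A S₁ S₂ α uc E b ψ K F ub (ut + v) p) :
    v ∈ V A S₁ ∧ ∀ h ∈ V A S₁,
      J Ω α uc E b ut v h - J Ω α uc E b ut v v + L Ω α uc E ψ ut v (h - v) ≥
        volumeWork Ω K (h - v) + surfaceWork A S₂ F (h - v) := by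
  have hv : v ∈ V A S₁ := by
    simpa only [add_sub_cancel_left] using sub_mem_V hΩ_open hΩ_bdd hreg.velocity_mem hut
      hreg.velocity_boundary hut_bdry hreg.incompressible hut_div
  exact ⟨hv, fun h hh =>
    hreg.volumeWork_add_surfaceWork_le hΩ_open hΩ_bdd hS hE hα hb hut hv hh⟩

theorem theorem4p1 {n : ℕ} (hn : n = 2 ∨ n = 3) {Ω : Set (ERFluid.Vec n)}
    (hΩ_open : IsOpen Ω) (hΩ_conn : IsConnected Ω) (hΩ_bdd : Bornology.IsBounded Ω)
    (A : ERFluid.LipschitzBoundary Ω)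
    {S₁ S₂ : Set (ERFluid.Vec n)} (hS : ERFluid.IsBoundarySplitting A S₁ S₂)
    (E : ERFluid.Vec n → ERFluid.Vec n) (hE : AEStronglyMeasurable E (volume.restrict Ω))
    (α : ℝ) (hα : 0 ≤ α) (uc : ERFluid.Vec n)
    (b : ℝ → ℝ → ℝ) (hb : ERFluid.PlasticityCoefficient b)
    (ψ : ℝ → ℝ → ℝ → ℝ)
    (hψ : ERFluid.DifferentiableMaterial ψ ∨ ERFluid.StronglyMonotoneMaterial ψ ∨
      ERFluid.StrictlyMonotoneMaterial ψ)
    (K F ub : ERFluid.Vec n → ERFluid.Vec n)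
    (hK : MemLp K 2 (volume.restrict Ω)) (hF : MemLp F 2 (A.surfaceMeasure.restrict S₂))
    (ut : ERFluid.Vec n → ERFluid.Vec n) (hut : ERFluid.MemH1Vec Ω ut)
    (hut_bdry : ERFluid.EqOnBoundary A S₁ ut ub) (hut_div : ERFluid.DivFree Ω ut)
    (v : ERFluid.Vec n → ERFluid.Vec n) (p : ERFluid.Vec n → ℝ)
    -- `α` is positive; the value `α = 0` is permitted if `u + uc ≠ 0` almost everywhere
    (hα_zero : α = 0 → ∀ᵐ x ∂(volume.restrict Ω), ut x + v x + uc ≠ 0)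
    (hreg : ERFluid.IsRegularSolution A S₁ S₂ α uc E b ψ K F ub (ut + v) p) :
    v ∈ ERFluid.V A S₁ ∧
      ∀ h ∈ ERFluid.V A S₁,
        ERFluid.J Ω α uc E b ut v h - ERFluid.J Ω α uc E b ut v v
            + ERFluid.L Ω α uc E ψ ut v (h - v) ≥
          ERFluid.volumeWork Ω K (h - v) + ERFluid.surfaceWork A S₂ F (h - v) := by
  exact theorem4p1_general hΩ_open hΩ_bdd A hS E hE α hα uc b hb ψ K F ub ut hut hut_bdry hut_div
    v p hα_zero hreg
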